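/- **Setting.** Let $S=\mathbb R$ or $S=\mathbb R^2$ (Euclidean norm $|\cdot|$), and let $X_1,X_2,\dots$ be i.i.d. stochastic processes on $S$ with continuous sample paths. For a probability density $\phi$ on $S$ let $$Z(t)=\max_{j\ge1}\frac{\phi(\xi_j-t)}{\eta_j},\qquad t\in S,$$ where $(\xi_j,\eta_j)_{j\ge1}$ are the points of a homogeneous Poisson process of unit intensity on $S\times(0,\infty)$. Suppose that there are continuous functions $a_n>0$ and $b_n$ on $S$ with $$\Big\{\frac{\max_{1\le i\le n}X_i(t)-b_n(t)}{a_n(t)}\Big\}_{t\in S}\longrightarrow\{\tilde Z(t)\}_{t\in S}\quad\text{weakly in }C(S),$$ where $\tilde Z$ has continuous paths and, for some continuous $\gamma:S\to\mathbb R$, $(1+\gamma(t)\tilde Z(t))_+^{1/\gamma(t)}$ (read as $e^{\tilde Z(t)}$ if $\gamma(t)=0$) is the process $Z$ of one of the following models, with $\beta>0$: * $S=\mathbb R$: $\phi(x)=\beta\varphi_0(\beta x)$ with $\varphi_0$ the standard normal density, $\varphi_0(x)=\frac12e^{-|x|}$, or the Student density with $\nu$ degrees of freedom, $\nu$ a positive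 integer. * $S=\mathbb R^2$, normal or $t$-model: $\phi(x)=\beta^2\varphi_0(\beta x)$ with $\varphi_0(x)=\frac1{2\pi}e^{-|x|^2/2}$ or $\varphi_0(x)=\frac1{2\pi}\big(1+\frac{|x|^2}{2(\alpha-1)}\big)^{-\alpha}$, $\alpha>1$. * $S=\mathbb R^2$, exponential model: $\phi(x)=\frac{\beta^2}{4}e^{-\beta(|x_1|+|x_2|)}$. * $S=\mathbb R^2$, general normal model, with $\beta_1,\beta_2>0$, $-1<\rho<1$: $\phi(x)=\frac{\beta_1\beta_2}{2\pi\sqrt{1-\rho^2}}\exp\big\{-\frac{1}{2(1-\rho^2)}(\beta_1^2x_1^2-2\rho\beta_1\beta_2x_1x_2+\beta_2^2x_2^2)\big\}$. Let $t_1,\dots,t_d\in S$ be distinct sites, $d\ge2$, and let $k=k(n)$ be integers with $k\to\infty$ and $k/n\to0$. For sites $s_1,\dots,s_r$ put $$\hat R_{s_1,\dots,s_r}=\frac1k\sum_{i=1}^n\mathbf 1\{X_i(s_j)\ge X_{n-k+1,n}(s_j)\text{ for }j=1,\dots,r\},$$ where $X_{1,n}(s)\le\dots\le X_{n,n}(s)$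 are the order statistics of $X_1(s),\dots,X_n(s)$. For a distribution function $F$ let $F^{\leftarrow}(p)=\inf\{u:F(u)\ge p\}$ (with any convention where this is not finite). **Theorem.** Under these assumptions, as $n\to\infty$: 1. In the models on $\mathbb R$, with $F(u)=\int_{-\infty}^u\varphi_0$, $$\hat\beta^{(1)}=\frac{2F^{\leftarrow}(1-\hat R_{t_1,\dots,t_d}/2)}{\max_jt_j-\min_jt_j},\qquad \hat\beta_1=\frac2{d(d-1)}\sum_{j<m}\frac{2}{|t_j-t_m|}F^{\leftarrow}(1-\hat R_{t_j,t_m}/2)$$ both converge to $\beta$ in probability. 2. In the normal and $t$-models on $\mathbb R^2$, with $F$ the first marginal distribution function of $\varphi_0$, $$\hat\beta_2=\frac2{d(d-1)}\sum_{j<m}\frac{2}{|t_j-t_m|}F^{\leftarrow}(1-\hat R_{t_j,t_m}/2)\to\beta\quad\text{in probability.}$$ 3. In the exponential model on $\mathbb R^2$, $$\hat\beta_{e,2}=\frac2{d(d-1)}\sum_{j<m}Q_{a_{jm},b_{jm}}(\hat R_{t_j,t_m})\to\beta\quad\text{in probability,}$$ where $a_{jm},b_{jm}$ are the absolute differences of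 the first and of the second coordinates of $t_j$ and $t_m$, and $Q_{a,b}(r)=\inf\{\beta\ge0:g_{a,b}(\beta)\le r\}$ (the value being arbitrary for $r\le0$) is the inverse of the decreasing function $g_{a,b}(\beta)=\big(1+\frac\beta2\min(a,b)\big)e^{-\frac\beta2(a+b)}$, $\beta\ge0$. 4. In the general normal model, let $\Phi$ be the standard normal distribution function, $\mathbf a=\frac1{1-\rho^2}(\beta_1^2,-2\rho\beta_1\beta_2,\beta_2^2)^T$, let $\Gamma$ be the $\frac{d(d-1)}2\times3$ matrix with rows $\mathbf t_{j,m}^T=(\Delta_1^2,\Delta_1\Delta_2,\Delta_2^2)$, $(\Delta_1,\Delta_2)=t_j-t_m$, $j<m$, and let $\hat{\mathbf q}$ be the vector with entries $\hat Q_{j,m}=\big(2\Phi^{\leftarrow}(1-\hat R_{t_j,t_m}/2)\big)^2$. Then $\hat Q_{j,m}\to\mathbf t_{j,m}^T\mathbf a$ in probability for all $j<m$. If moreover $\Gamma^T\Gamma$ is invertible and $\hat{\mathbf a}=(\Gamma^T\Gamma)^{-1}\Gamma^T\hat{\mathbf q}$, then, in probability, $\hat{\mathbf a}\to\mathbf a$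 and $$\sqrt{\hat a_1-\frac{\hat a_2^2}{4\hat a_3}}\to\beta_1,\qquad\sqrt{\hat a_3-\frac{\hat a_2^2}{4\hat a_1}}\to\beta_2,\qquad-\frac{\hat a_2}{2\sqrt{\hat a_1\hat a_3}}\to\rho .$$ -/

import Mathlib

open Set Filter Topology MeasureTheory ProbabilityTheory

noncomputable section

namespace SpatialExtremes

/-- The path space `C(S, ℝ)` (topology of uniform convergence on compact sets) with its
Borel σ-algebra. -/
instance pathMeasurableSpace {S : Type*} [TopologicalSpace S] : MeasurableSpace C(S, ℝ) :=
  borel _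

instance pathBorelSpace {S : Type*} [TopologicalSpace S] : BorelSpace C(S, ℝ) := ⟨rfl⟩

/-- The plane with the Euclidean norm. -/
abbrev Plane : Type := EuclideanSpace ℝ (Fin 2)

/-! ### Poisson processes and moving maxima -/

/-- The number of the points `ξ 0 ω, ξ 1 ω, …` that lie in `A`. -/
def pointCount {Ω E : Type*} (ξ : ℕ → Ω → E) (A : Set E) (ω : Ω) : ℕ∞ :=
  {j : ℕ | ξ j ω ∈ A}.encard

/-- The random points `ξ 0, ξ 1, …` are the points of a Poisson process with intensity
measure `Λ`. -/
structure IsPoissonProcess {Ω E : Type*} [MeasurableSpace Ω] [MeasurableSpace E]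
    (P : Measure Ω) (ξ : ℕ → Ω → E) (Λ : Measure E) : Prop where
  measurable : ∀ j, Measurable (ξ j)
  poisson : ∀ A : Set E, MeasurableSet A → Λ A ≠ ⊤ → ∀ m : ℕ,
    P {ω | pointCount ξ A ω = (m : ℕ∞)} = poissonMeasure (Λ A).toNNReal {m}
  indep : ∀ (r : ℕ) (A : Fin r → Set E), (∀ i, MeasurableSet (A i)) →
    Pairwise (fun i j => Disjoint (A i) (A j)) →
    iIndepFun (fun i ω => pointCount ξ (A i) ω) P

/-- `Z` is the moving maximum process `Z(t) = max_j φ(x_j - t) / y_j`, where the `(x_j, y_j)` are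
the points of the homogeneous Poisson process of unit intensity on `S × (0, ∞)`. -/
def IsMovingMaximum {Ω S : Type*} [MeasurableSpace Ω] [MeasureSpace S] [Sub S]
    (P : Measure Ω) (φ : S → ℝ) (Z : Ω → S → ℝ) : Prop :=
  ∃ (x : ℕ → Ω → S) (y : ℕ → Ω → ℝ),
    IsPoissonProcess P (fun j ω => (x j ω, y j ω))
      ((volume : Measure S).prod ((volume : Measure ℝ).restrict (Ioi 0))) ∧
    ∀ᵐ ω ∂P, ∀ t : S, IsGreatest (range fun j => φ (x j ω - t) / y j ω) (Z ω t)

/-- `(1 + γ z)_+ ^ (1 / γ)`, read as `exp z` for `γ = 0`. -/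
def standardize (γ z : ℝ) : ℝ :=
  if γ = 0 then Real.exp z else max (1 + γ * z) 0 ^ (1 / γ)

/-- `Zt` is a max-stable process whose standardization `(1 + γ(t) Zt(t))_+ ^ (1 / γ(t))`, for some
continuous function `γ`, is the moving maximum process of the density `φ`. -/
def IsModelLimit {Ω S : Type*} [MeasurableSpace Ω] [MeasureSpace S] [TopologicalSpace S] [Sub S]
    (P : Measure Ω) (φ : S → ℝ) (Zt : Ω → C(S, ℝ)) : Prop :=
  ∃ γ : C(S, ℝ), IsMovingMaximum P φ fun ω t => standardize (γ t) (Zt ω t)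

/-! ### Convergence of normalized maxima -/

/-- The path `(max (x 0, …, x n) - b) / a`, the normalized maximum of the first `n + 1` paths. -/
def normalizedMax {S : Type*} [TopologicalSpace S] (n : ℕ) (x : ℕ → C(S, ℝ)) (a b : C(S, ℝ))
    (ha : ∀ t, 0 < a t) : C(S, ℝ) where
  toFun t :=
    ((Finset.range (n + 1)).sup' Finset.nonempty_range_add_one (fun i => x i t) - b t) / a t
  continuous_toFun :=
    ((Continuous.finset_sup'_apply Finset.nonempty_range_add_one
      fun i _ => (x i).continuous).sub b.continuous).div a.continuous fun t => (ha t).ne'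

/-- The `X i` are i.i.d. random continuous paths, and for suitable continuous norming functions
`a n > 0` and `b n` (those of sample size `n + 1`) the normalized maxima converge weakly to `Zt`
in `C(S, ℝ)`. -/
structure MaximaConverge {Ω Ω' S : Type*} [MeasurableSpace Ω] [MeasurableSpace Ω']
    [TopologicalSpace S] (P : Measure Ω) [IsProbabilityMeasure P] (X : ℕ → Ω → C(S, ℝ))
    (P' : Measure Ω') [IsProbabilityMeasure P'] (Zt : Ω' → C(S, ℝ)) : Prop where
  measurable : ∀ i, Measurable (X i)
  indep : iIndepFun X P
  ident : ∀ i, IdentDistrib (X i) (X 0) P P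
  conv : ∃ (a b : ℕ → C(S, ℝ)) (ha : ∀ n t, 0 < a n t),
    TendstoInDistribution
      (fun n ω => normalizedMax n (fun i => X i ω) (a n) (b n) (ha n)) atTop Zt (fun _ => P) P'

/-! ### The standardized densities and distribution functions -/

/-- The standard normal density on the line. -/
def normalDensity (x : ℝ) : ℝ := 1 / Real.sqrt (2 * Real.pi) * Real.exp (-x ^ 2 / 2)

/-- The double exponential density on the line. -/
def expDensity (x : ℝ) : ℝ := 1 / 2 * Real.exp (-|x|)

/-- The Student density on the line with `ν` degrees of freedom. -/
def studentDensity (ν : ℕ) (x : ℝ) : ℝ :=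
  Real.Gamma (((ν : ℝ) + 1) / 2) / (Real.sqrt (Real.pi * ν) * Real.Gamma ((ν : ℝ) / 2)) *
    (1 + x ^ 2 / ν) ^ (-(((ν : ℝ) + 1) / 2))

/-- The standard normal density on the plane. -/
def normalDensity₂ (x : Plane) : ℝ :=
  1 / (2 * Real.pi) * Real.exp (-(x 0 ^ 2 + x 1 ^ 2) / 2)

/-- The exponential density on the plane. -/
def expDensity₂ (x : Plane) : ℝ := 1 / 4 * Real.exp (-(|x 0| + |x 1|))

/-- The t-density on the plane with parameter `α > 1`. -/
def studentDensity₂ (α : ℝ) (x : Plane) : ℝ :=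
  1 / (2 * Real.pi) * (1 + (x 0 ^ 2 + x 1 ^ 2) / (2 * (α - 1))) ^ (-α)

/-- The general normal density on the plane. -/
def generalNormalDensity (β₁ β₂ ρ : ℝ) (x : Plane) : ℝ :=
  β₁ * β₂ / (2 * Real.pi * Real.sqrt (1 - ρ ^ 2)) *
    Real.exp (-(1 / (2 * (1 - ρ ^ 2)) *
      (β₁ ^ 2 * x 0 ^ 2 - 2 * ρ * β₁ * β₂ * x 0 * x 1 + β₂ ^ 2 * x 1 ^ 2)))

/-- The standardized densities of the three models on the line. -/
def lineDensities : Set (ℝ → ℝ) :=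
  {normalDensity, expDensity} ∪ {φ₀ | ∃ ν : ℕ, 0 < ν ∧ φ₀ = studentDensity ν}

/-- The standardized densities of the two spherically symmetric models on the plane. -/
def sphericalDensities : Set (Plane → ℝ) :=
  {normalDensity₂} ∪ {φ₀ | ∃ α : ℝ, 1 < α ∧ φ₀ = studentDensity₂ α}

/-- The distribution function of a density on the line. -/
def distFun (φ₀ : ℝ → ℝ) (u : ℝ) : ℝ := ∫ s in Iic u, φ₀ s

/-- The distribution function of the first marginal of a density on the plane. -/
def marginalDistFun (φ₀ : Plane → ℝ) (u : ℝ) : ℝ := ∫ x in {x : Plane | x 0 ≤ u}, φ₀ x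

/-- The inverse of a distribution function; for a continuous strictly increasing `F` it is the
inverse function on `(0, 1)`. -/
def quantile (F : ℝ → ℝ) (p : ℝ) : ℝ := sInf {u | p ≤ F u}

/-! ### The estimators -/

/-- The `m`-th order statistic (`1 ≤ m ≤ n`): the `m`-th smallest of `x 0, …, x (n - 1)`. -/
def orderStat {n : ℕ} (x : Fin n → ℝ) (m : ℕ) : ℝ :=
  if h : 0 < m ∧ m ≤ n then x (Tuple.sort x ⟨m - 1, by omega⟩) else 0

/-- `R̂_{t_1, …, t_d}(x_1, …, x_d)`, computed from the first `n` of the paths `X`. -/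
def RHat {S ι : Type*} [TopologicalSpace S] (n k : ℕ) (X : ℕ → C(S, ℝ)) (t : ι → S)
    (x : ι → ℝ) : ℝ :=
  1 / (k : ℝ) * ({i : Fin n | ∀ j,
    orderStat (fun l : Fin n => X l (t j)) (n - ⌊(k : ℝ) * x j⌋₊ + 1) ≤ X i (t j)}.ncard : ℝ)

/-- `R̂_{s, t}(1, 1)` for two sites. -/
def RHatPair {S : Type*} [TopologicalSpace S] (n k : ℕ) (X : ℕ → C(S, ℝ)) (s t : S) : ℝ :=
  RHat n k X ![s, t] ![1, 1]

/-- The estimator `β̂⁽¹⁾`. -/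
def betaHatRange {d : ℕ} (F : ℝ → ℝ) (n k : ℕ) (X : ℕ → C(ℝ, ℝ)) (t : Fin d → ℝ) : ℝ :=
  2 * quantile F (1 - RHat n k X t (fun _ => 1) / 2) / ((⨆ j, t j) - ⨅ j, t j)

/-- The average of `f j m` over the pairs of sites `j < m`. -/
def pairAverage (d : ℕ) (f : Fin d → Fin d → ℝ) : ℝ :=
  2 / ((d : ℝ) * ((d : ℝ) - 1)) *
    ∑ p ∈ Finset.univ.filter (fun p : Fin d × Fin d => p.1 < p.2), f p.1 p.2

/-- The estimators `β̂_1` (sites on the line) and `β̂_2` (sites in the plane). -/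
def betaHatPairs {S : Type*} [NormedAddCommGroup S] {d : ℕ} (F : ℝ → ℝ) (n k : ℕ)
    (X : ℕ → C(S, ℝ)) (t : Fin d → S) : ℝ :=
  pairAverage d fun j m =>
    2 / ‖t j - t m‖ * quantile F (1 - RHatPair n k X (t j) (t m) / 2)

/-- `R(1, 1)` in the exponential model on the plane, for two sites whose coordinates differ by
`a` and `b` in absolute value. -/
def expDep (a b β : ℝ) : ℝ := (1 + β / 2 * min a b) * Real.exp (-(β / 2 * (a + b)))

/-- `Q_{a, b}`, the inverse on `[0, ∞)` of the decreasing function `expDep a b`. -/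
def Q (a b r : ℝ) : ℝ := sInf {β | 0 ≤ β ∧ expDep a b β ≤ r}

/-- The estimator `β̂_{e,2}`. -/
def betaHatExp {d : ℕ} (n k : ℕ) (X : ℕ → C(Plane, ℝ)) (t : Fin d → Plane) : ℝ :=
  pairAverage d fun j m =>
    Q |t j 0 - t m 0| |t j 1 - t m 1| (RHatPair n k X (t j) (t m))

/-! ### The estimators in the general normal model -/

/-- The pairs `j < m` of sites. -/
abbrev Pairs (d : ℕ) : Type := {p : Fin d × Fin d // p.1 < p.2}

/-- The vector `𝐚` of the general normal model. -/
def coefVec (β₁ β₂ ρ : ℝ) : Fin 3 → ℝ :=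
  (1 / (1 - ρ ^ 2)) • ![β₁ ^ 2, -2 * ρ * β₁ * β₂, β₂ ^ 2]

/-- The matrix `Γ`, whose rows are the vectors `𝐭_{j,m}`, `j < m`. -/
def designMatrix {d : ℕ} (t : Fin d → Plane) : Matrix (Pairs d) (Fin 3) ℝ :=
  Matrix.of fun p => ![(t p.1.1 0 - t p.1.2 0) ^ 2,
    (t p.1.1 0 - t p.1.2 0) * (t p.1.1 1 - t p.1.2 1), (t p.1.1 1 - t p.1.2 1) ^ 2]

/-- The vector `q̂` of the estimators `Q̂_{j,m} = (2 Φ⁻¹(1 - R̂(1, 1) / 2))²`. -/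
def qHat {d : ℕ} (n k : ℕ) (X : ℕ → C(Plane, ℝ)) (t : Fin d → Plane) (p : Pairs d) : ℝ :=
  (2 * quantile (distFun normalDensity) (1 - RHatPair n k X (t p.1.1) (t p.1.2) / 2)) ^ 2

/-- The least squares estimator `â = (Γᵀ Γ)⁻¹ Γᵀ q̂`. -/
def aHat {d : ℕ} (n k : ℕ) (X : ℕ → C(Plane, ℝ)) (t : Fin d → Plane) : Fin 3 → ℝ :=
  (((designMatrix t).transpose * designMatrix t)⁻¹ * (designMatrix t).transpose).mulVec
    (qHat n k X t)

/-- `β_1` as a function of `𝐚`. -/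
def beta₁Of (a : Fin 3 → ℝ) : ℝ := Real.sqrt (a 0 - a 1 ^ 2 / (4 * a 2))

/-- `β_2` as a function of `𝐚`. -/
def beta₂Of (a : Fin 3 → ℝ) : ℝ := Real.sqrt (a 2 - a 1 ^ 2 / (4 * a 0))

/-- `ρ` as a function of `𝐚`. -/
def rhoOf (a : Fin 3 → ℝ) : ℝ := -(a 1 / (2 * Real.sqrt (a 0 * a 2)))

/-- Weak consistency: convergence in probability of the estimators `T n` to `θ`. -/
def WeaklyConsistent {Ω : Type*} [MeasurableSpace Ω] (P : Measure Ω) (T : ℕ → Ω → ℝ) (θ : ℝ) :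
    Prop :=
  TendstoInMeasure P T atTop fun _ => θ

end SpatialExtremes

end

open SpatialExtremes

/-!
Every estimator is a continuous function of the empirical tail dependence coefficients
`R̂ (1, …, 1)` at the true parameter, so the theorem reduces to the consistency of `R̂` and to the
evaluation of its limit.

**Consistency of `R̂`** (`weaklyConsistent_RHat`). The moving maximum process does not exceed `z` at
given sites iff its Poisson process has no point in a certain set, so its joint distribution
function on the diagonal is `exp (-(∫ max_j φ (x - s j) dx) / z)` (`prob_movingMaximum_le`).
Only this finite-dimensional consequence of the convergence in `C(S)` is needed. It gives levels
`u j n` with `n P (X (s j) > u j n for some j ∈ T) → (∫ max_{j ∈ T} φ (x - s j) dx) / z`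
(`tendsto_tail`). Inclusion and exclusion, in the form that both sides are valuations
(`tendsto_measure_iInter_of_iUnion`), turns this into
`n P (X (s j) > u j n for all j) → (∫ min_j φ (x - s j) dx) / z`. Used at the block length `n / k`,
with Chebyshev's inequality (`weaklyConsistent_ncard_div`), this determines the numbers of
exceedances of these levels, divided by `k`. For a single site the limit is `1 / z`; hence the
random threshold `X_{n - k + 1, n}` lies between the levels with `z < 1` and with `z > 1`, and `R̂`
is squeezed to `∫ min_j φ (x - s j) dx`. Neither ties nor discontinuous marginals matter here.

**The limit.** All densities but the exponential one on the plane are linear images of positive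
densities that decrease strictly with the norm. For such a density and two sites the integral of the
minimum splits along the perpendicular bisector into two halves of equal mass, each that of a
half-space (`IsRadialDensity.integral_min`), and on the line only the two extreme sites count
(`tailDep_line`). In the exponential model the integral is computed with Fubini's theorem
(`tailDep_expDensity₂`). The half-space mass and the function `expDep a b` are strictly monotone, so
their inverses are continuous (`continuousAt_quantile`, `continuousAt_Q`).
-/

namespace SpatialExtremes

/-! ### Convergence in probability -/

/-- The continuous mapping theorem for finitely many estimators; no measurability is needed. -/
theorem WeaklyConsistent.comp_pi {Ω ι : Type*} [MeasurableSpace Ω] [Fintype ι] {P : Measure Ω}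
    {T : ι → ℕ → Ω → ℝ} {θ : ι → ℝ} (h : ∀ i, WeaklyConsistent P (T i) (θ i))
    {f : (ι → ℝ) → ℝ} (hf : ContinuousAt f θ) :
    WeaklyConsistent P (fun n ω => f fun i => T i n ω) (f θ) := by
  unfold WeaklyConsistent at *
  simp only [tendstoInMeasure_iff_norm] at *
  intro ε hε
  obtain ⟨δ, hδ, hfδ⟩ := Metric.continuousAt_iff.1 hf ε hε
  have hsum : Tendsto (fun n => ∑ i, P {ω | δ ≤ ‖T i n ω - θ i‖}) atTop (𝓝 0) := by
    simpa using tendsto_finsetSum Finset.univ fun i _ => h i δ hδ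
  refine tendsto_of_tendsto_of_tendsto_of_le_of_le tendsto_const_nhds hsum
    (fun _ => zero_le) fun n => (measure_mono ?_).trans (measure_iUnion_fintype_le P _)
  intro ω hω
  by_contra hcon
  simp only [mem_iUnion, mem_ofPred_eq, not_exists, not_le] at hcon
  have hdist : dist (fun i => T i n ω) θ < δ :=
    (dist_pi_lt_iff hδ).2 fun i => by simpa [Real.dist_eq] using hcon i
  have := hfδ hdist
  rw [Real.dist_eq] at this
  exact (not_lt.2 hω) this

theorem WeaklyConsistent.comp {Ω : Type*} [MeasurableSpace Ω] {P : Measure Ω}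
    {T : ℕ → Ω → ℝ} {θ : ℝ} (h : WeaklyConsistent P T θ) {f : ℝ → ℝ} (hf : ContinuousAt f θ) :
    WeaklyConsistent P (fun n ω => f (T n ω)) (f θ) :=
  WeaklyConsistent.comp_pi (ι := Unit) (T := fun _ => T) (θ := fun _ => θ) (fun _ => h)
    (f := fun x => f (x ())) (hf.comp (f := fun x : Unit → ℝ => x ())
      (continuous_apply ()).continuousAt)

/-! ### Order statistics -/

/-- The `k`-th largest value is at most `u` iff fewer than `k` values exceed `u`. -/
theorem orderStat_le_iff {n k : ℕ} (x : Fin n → ℝ) (hk : 0 < k) (hkn : k ≤ n) (u : ℝ) :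
    orderStat x (n - k + 1) ≤ u ↔ {i | u < x i}.ncard < k := by
  have hm : 0 < n - k + 1 ∧ n - k + 1 ≤ n := by omega
  rw [orderStat, dif_pos hm]
  set j₀ : Fin n := ⟨n - k + 1 - 1, by omega⟩ with hj₀
  have hmono : Monotone (x ∘ Tuple.sort x) := Tuple.monotone_sort x
  have hcard : {i | u < x i}.ncard = {i | u < x (Tuple.sort x i)}.ncard := by
    have : {i | u < x i} = Tuple.sort x '' {i | u < x (Tuple.sort x i)} := by
      ext i
      simp only [mem_ofPred_eq, mem_image]
      exact ⟨fun h => ⟨(Tuple.sort x).symm i, by simpa using h, by simp⟩,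
        by rintro ⟨l, hl, rfl⟩; exact hl⟩
    rw [this, ncard_image_of_injective _ (Tuple.sort x).injective]
  rw [hcard]
  constructor
  · intro h
    have hsub : {i | u < x (Tuple.sort x i)} ⊆ (Finset.Ioi j₀ : Finset (Fin n)) := by
      intro i hi
      by_contra hcon
      simp only [Finset.coe_Ioi, mem_Ioi, not_lt] at hcon
      exact absurd (hmono hcon) (not_le.2 (h.trans_lt hi))
    have := ncard_le_ncard hsub (Finset.finite_toSet _)
    rw [ncard_coe_finset, Fin.card_Ioi] at this
    simp only [hj₀] at this
    omega
  · intro h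
    by_contra! hcon
    have hsub : (Finset.Ici j₀ : Set (Fin n)) ⊆ {i | u < x (Tuple.sort x i)} := by
      intro i hi
      simp only [Finset.coe_Ici, mem_Ici] at hi
      exact hcon.trans_le (hmono hi)
    have := ncard_le_ncard hsub (toFinite _)
    rw [ncard_coe_finset, Fin.card_Ici] at this
    simp only [hj₀] at this
    omega

/-! ### Continuity of the inverse of a monotone function -/

/-- A monotone `F` that is strictly increasing at `v` has a generalized inverse continuous at `F v`;
continuity of `F` is not needed. -/
theorem continuousAt_quantile {F : ℝ → ℝ} (hF : Monotone F) {v : ℝ}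
    (hl : ∀ u < v, F u < F v) (hr : ∀ u, v < u → F v < F u) :
    ContinuousAt (quantile F) (F v) ∧ quantile F (F v) = v := by
  have key : ∀ ε > 0, ∀ p, F (v - ε) < p → p ≤ F (v + ε) →
      |quantile F p - v| ≤ ε := by
    intro ε hε p h1 h2
    have hlow : ∀ u ∈ {u | p ≤ F u}, v - ε ≤ u := fun u hu => by
      by_contra! hcon
      exact absurd (hF hcon.le) (not_le.2 (h1.trans_le hu))
    have h3 : v - ε ≤ quantile F p := le_csInf ⟨_, h2⟩ hlow
    have h4 : quantile F p ≤ v + ε := csInf_le ⟨_, hlow⟩ h2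
    rw [abs_le]; constructor <;> linarith
  have hv : quantile F (F v) = v := by
    refine eq_of_abs_sub_le_all fun ε hε => ?_
    exact key ε hε _ (hl _ (by linarith)) (hr _ (by linarith)).le
  refine ⟨?_, hv⟩
  rw [Metric.continuousAt_iff']
  intro ε hε
  have h1 := hl (v - ε / 2) (by linarith)
  have h2 := hr (v + ε / 2) (by linarith)
  filter_upwards [Ioo_mem_nhds h1 h2] with p hp
  rw [hv, Real.dist_eq]
  exact (key (ε / 2) (by linarith) p hp.1 hp.2.le).trans_lt (by linarith)

theorem expDep_strictAntiOn {a b : ℝ} (ha : 0 ≤ a) (hb : 0 ≤ b) (hab : 0 < a + b) :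
    StrictAntiOn (expDep a b) (Ici 0) := by
  intro x hx y hy hxy
  unfold expDep
  rw [mem_Ici] at hx hy
  have hm : 0 ≤ min a b := le_min ha hb
  have hms : min a b < a + b := by
    rcases min_choice a b with h | h <;> rcases lt_or_eq_of_le ha with h1 | h1 <;>
      rcases lt_or_eq_of_le hb with h2 | h2 <;> rcases min_le_iff.1 h.le with h3 | h3 <;>
      linarith [min_le_left a b, min_le_right a b]
  set m := min a b
  set s := a + b
  -- With `δ = (y - x) / 2 > 0` one has `(1 + m y / 2) / (1 + m x / 2) ≤ 1 + m δ < exp (s δ)`.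
  have h1 : 1 + y / 2 * m < (1 + x / 2 * m) * Real.exp ((y - x) / 2 * s) := by
    have h2 : (y - x) / 2 * s + 1 ≤ Real.exp ((y - x) / 2 * s) := Real.add_one_le_exp _
    have h3 : (y - x) / 2 * m < (y - x) / 2 * s := by
      apply mul_lt_mul_of_pos_left hms; linarith
    have h4 : 0 ≤ x / 2 * m := by positivity
    have h5 : 0 ≤ (y - x) / 2 * m := mul_nonneg (by linarith) hm
    nlinarith [mul_nonneg h4 h5]
  calc (1 + y / 2 * m) * Real.exp (-(y / 2 * s))
      < ((1 + x / 2 * m) * Real.exp ((y - x) / 2 * s)) * Real.exp (-(y / 2 * s)) :=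
        mul_lt_mul_of_pos_right h1 (Real.exp_pos _)
    _ = _ := by rw [mul_assoc, ← Real.exp_add]; congr 2; ring

theorem continuousAt_Q {a b β : ℝ} (ha : 0 ≤ a) (hb : 0 ≤ b) (hab : 0 < a + b) (hβ : 0 < β) :
    ContinuousAt (Q a b) (expDep a b β) ∧ Q a b (expDep a b β) = β := by
  have hg := expDep_strictAntiOn ha hb hab
  have key : ∀ ε > 0, ε < β → ∀ r, r < expDep a b (β - ε) → expDep a b (β + ε) ≤ r →
      |Q a b r - β| ≤ ε := by
    intro ε hε hεβ r h1 h2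
    have hlow : ∀ u ∈ {u | 0 ≤ u ∧ expDep a b u ≤ r}, β - ε ≤ u := fun u hu => by
      by_contra! hcon
      exact absurd (hg hu.1 (by rw [mem_Ici]; linarith) hcon) (not_lt.2 (hu.2.trans h1.le))
    have hmem : β + ε ∈ {u | 0 ≤ u ∧ expDep a b u ≤ r} := ⟨by linarith, h2⟩
    have h3 : β - ε ≤ Q a b r := le_csInf ⟨_, hmem⟩ hlow
    have h4 : Q a b r ≤ β + ε := csInf_le ⟨_, hlow⟩ hmem
    rw [abs_le]; constructor <;> linarith
  have hl : ∀ ε > 0, ε < β → expDep a b β < expDep a b (β - ε) := fun ε h1 h2 =>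
    hg (by rw [mem_Ici]; linarith) (by rw [mem_Ici]; linarith) (by linarith)
  have hr : ∀ ε > 0, expDep a b (β + ε) < expDep a b β := fun ε h1 =>
    hg (by rw [mem_Ici]; linarith) (by rw [mem_Ici]; linarith) (by linarith)
  have hv : Q a b (expDep a b β) = β := by
    refine eq_of_abs_sub_le_all fun ε hε => ?_
    have h0 : 0 < min ε (β / 2) := lt_min hε (by linarith)
    have h1 : min ε (β / 2) < β := (min_le_right _ _).trans_lt (by linarith)
    exact (key _ h0 h1 _ (hl _ h0 h1) (hr _ h0).le).trans (min_le_left _ _)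
  refine ⟨?_, hv⟩
  rw [Metric.continuousAt_iff']
  intro ε hε
  have h0 : 0 < min (ε / 2) (β / 2) := lt_min (by linarith) (by linarith)
  have h1 : min (ε / 2) (β / 2) < β := (min_le_right _ _).trans_lt (by linarith)
  filter_upwards [Ioo_mem_nhds (hr _ h0) (hl _ h0 h1)] with p hp
  rw [hv, Real.dist_eq]
  exact (key _ h0 h1 p hp.2 hp.1.le).trans_lt ((min_le_left _ _).trans_lt (by linarith))

/-! ### From joint distribution functions to tails -/

/-- Squeeze by `p (-log p) ≤ 1 - p ≤ -log p`. -/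
theorem tendsto_mul_one_sub_of_tendsto_pow {p : ℕ → ℝ} {c : ℝ} (h0 : ∀ n, 0 ≤ p n)
    (h : Tendsto (fun n => p n ^ (n + 1)) atTop (𝓝 (Real.exp (-c)))) :
    Tendsto (fun n : ℕ => ((n : ℝ) + 1) * (1 - p n)) atTop (𝓝 c) := by
  have hpos : ∀ᶠ n in atTop, 0 < p n := by
    filter_upwards [h.eventually (lt_mem_nhds (Real.exp_pos (-c)))] with n hn
    exact (h0 n).lt_of_ne' fun hz => by simp [hz] at hn
  have hlog : Tendsto (fun n : ℕ => -(((n : ℝ) + 1) * Real.log (p n))) atTop (𝓝 c) := by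
    have := ((Real.continuousAt_log (Real.exp_pos (-c)).ne').tendsto.comp h).neg
    rw [Real.log_exp, neg_neg] at this
    refine this.congr fun n => ?_
    simp [Function.comp, Real.log_pow]
  have hlog0 : Tendsto (fun n => Real.log (p n)) atTop (𝓝 0) := by
    have := (hlog.mul tendsto_one_div_add_atTop_nhds_zero_nat).neg
    simp only [mul_zero, neg_zero] at this
    refine this.congr fun n => ?_
    have : (n : ℝ) + 1 ≠ 0 := by positivity
    field_simp
  have hp1 : Tendsto p atTop (𝓝 1) := by
    have := (Real.continuous_exp.tendsto 0).comp hlog0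
    rw [Real.exp_zero] at this
    refine this.congr' ?_
    filter_upwards [hpos] with n hn
    exact Real.exp_log hn
  have hlow := hp1.mul hlog
  rw [one_mul] at hlow
  refine tendsto_of_tendsto_of_tendsto_of_le_of_le' hlow hlog ?_ ?_
  · filter_upwards [hpos] with n hn
    have h1 := Real.one_sub_inv_le_log_of_pos hn
    have h2 : p n * (-Real.log (p n)) ≤ 1 - p n := by
      have := mul_le_mul_of_nonneg_left h1 hn.le
      rw [mul_sub, mul_inv_cancel₀ hn.ne'] at this
      linarith
    have h3 : (0 : ℝ) ≤ (n : ℝ) + 1 := by positivity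
    nlinarith [mul_le_mul_of_nonneg_left h2 h3]
  · filter_upwards [hpos] with n hn
    have h1 := Real.log_le_sub_one_of_pos hn
    have h3 : (0 : ℝ) ≤ (n : ℝ) + 1 := by positivity
    nlinarith [mul_le_mul_of_nonneg_left h1 h3]

open scoped NNReal in
/-- If the scaled measures of all finite unions of the sets `A j n` converge to the integrals of
the corresponding maxima of the functions `f j`, then those of their intersections converge to the
integrals of the minima: both sides are valuations, that is, `P (U ∩ V) = P U + P V - P (U ∪ V)`
and `min g h = g + h - max g h`. -/
theorem tendsto_measure_iInter_of_iUnion {Ω E ι : Type*} [MeasurableSpace Ω] [MeasurableSpace E]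
    [Fintype ι] [Nonempty ι] [DecidableEq ι] {P : Measure Ω} [IsFiniteMeasure P] {μ : Measure E}
    {c : ℕ → ℝ} {A : ι → ℕ → Set Ω} {f : ι → E → ℝ≥0} (hA : ∀ j n, MeasurableSet (A j n))
    (hfi : ∀ j, Integrable (fun x => (f j x : ℝ)) μ)
    (h : ∀ T : Finset ι, Tendsto (fun n => c n * P.real {ω | ∃ j ∈ T, ω ∈ A j n}) atTop
      (𝓝 (∫ x, ((T.sup fun j => f j x : ℝ≥0) : ℝ) ∂μ))) :
    Tendsto (fun n => c n * P.real {ω | ∀ j, ω ∈ A j n}) atTop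
      (𝓝 (∫ x, ((Finset.univ.inf' Finset.univ_nonempty fun j => f j x : ℝ≥0) : ℝ) ∂μ)) := by
  have hsupi : ∀ T : Finset ι, Integrable (fun x => ((T.sup fun j => f j x : ℝ≥0) : ℝ)) μ := by
    intro T
    induction T using Finset.induction_on with
    | empty => simp
    | insert a T _ ih =>
      simp only [Finset.sup_insert, NNReal.coe_max]
      exact (hfi a).sup ih
  have hAT : ∀ (T : Finset ι) n, MeasurableSet {ω | ∃ j ∈ T, ω ∈ A j n} := fun T n => by
    have : {ω | ∃ j ∈ T, ω ∈ A j n} = ⋃ j ∈ T, A j n := by ext; simp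
    rw [this]; exact T.measurableSet_biUnion fun j _ => hA j n
  have key : ∀ (s : Finset ι) (hs : s.Nonempty), ∀ T : Finset ι,
      Integrable (fun x => ((max (s.inf' hs fun j => f j x) (T.sup fun j => f j x) : ℝ≥0) : ℝ)) μ ∧
      Tendsto (fun n => c n * P.real {ω | (∀ j ∈ s, ω ∈ A j n) ∨ ∃ j ∈ T, ω ∈ A j n}) atTop
        (𝓝 (∫ x, ((max (s.inf' hs fun j => f j x) (T.sup fun j => f j x) : ℝ≥0) : ℝ) ∂μ)) := by
    intro s hs
    induction hs using Finset.Nonempty.cons_induction with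
    | singleton a =>
      intro T
      have h1 := h (insert a T)
      have h2 := hsupi (insert a T)
      simp only [Finset.sup_insert, NNReal.coe_max, Finset.exists_mem_insert] at h1 h2
      simpa using And.intro h2 h1
    | cons a s ha hs ih =>
      intro T
      have h1 := h (insert a T)
      have h2 := hsupi (insert a T)
      simp only [Finset.sup_insert, NNReal.coe_max, Finset.exists_mem_insert] at h1 h2
      obtain ⟨i1, t1⟩ := ih T
      obtain ⟨i2, t2⟩ := ih (insert a T)
      simp only [Finset.sup_insert, NNReal.coe_max, Finset.exists_mem_insert] at i2 t2
      have hfun : ∀ x, ((max ((Finset.cons a s ha).inf' (Finset.cons_nonempty ha)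
          fun j => f j x) (T.sup fun j => f j x) : ℝ≥0) : ℝ) =
          max ((s.inf' hs fun j => f j x : ℝ≥0) : ℝ) ((T.sup fun j => f j x : ℝ≥0) : ℝ) +
          max (f a x : ℝ) ((T.sup fun j => f j x : ℝ≥0) : ℝ) -
          max ((s.inf' hs fun j => f j x : ℝ≥0) : ℝ)
            (max (f a x : ℝ) ((T.sup fun j => f j x : ℝ≥0) : ℝ)) := by
        intro x
        rw [Finset.inf'_cons hs]
        simp only [NNReal.coe_max, NNReal.coe_min]
        generalize ((s.inf' hs fun j => f j x : ℝ≥0) : ℝ) = p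
        generalize ((T.sup fun j => f j x : ℝ≥0) : ℝ) = q
        generalize (f a x : ℝ) = r
        grind
      simp only [NNReal.coe_max] at i1 t1 hfun ⊢
      simp only [hfun]
      refine ⟨(i1.add h2).sub i2, ?_⟩
      have hlim := (t1.add h1).sub t2
      rw [← integral_add' i1 h2, ← integral_sub (i1.add h2) i2] at hlim
      refine hlim.congr fun n => ?_
      set U : Set Ω := {ω | (∀ j ∈ s, ω ∈ A j n) ∨ ∃ j ∈ T, ω ∈ A j n}
      set V : Set Ω := {ω | ω ∈ A a n ∨ ∃ j ∈ T, ω ∈ A j n}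
      have hV : MeasurableSet V := (hA a n).union (hAT T n)
      have hU' : {ω | (∀ j ∈ s, ω ∈ A j n) ∨ ω ∈ A a n ∨ ∃ j ∈ T, ω ∈ A j n} = U ∪ V := by
        ext ω; simp only [U, V, mem_union, mem_ofPred_eq]; tauto
      have hI' : {ω | (∀ j ∈ Finset.cons a s ha, ω ∈ A j n) ∨ ∃ j ∈ T, ω ∈ A j n} = U ∩ V := by
        ext ω; simp only [U, V, mem_inter_iff, mem_ofPred_eq, Finset.forall_mem_cons]; tauto
      rw [hU', hI']
      have := measureReal_union_add_inter (μ := P) (s := U) hV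
      linear_combination (c n) * (-this)
  have := (key Finset.univ Finset.univ_nonempty ∅).2
  simpa using this

/-! ### Finite-dimensional distributions of the limit process -/

section
open scoped NNReal

/-- The maximum over the sites `s j`, `j ∈ T`, of the shifted density `φ (x - s j)`; its integral is
the exponent in the joint distribution function of the moving maximum process. -/
noncomputable def shiftMax {E ι : Type*} [Sub E] (φ : E → ℝ) (s : ι → E) (T : Finset ι) (x : E) :
    ℝ :=
  ((T.sup fun j => (φ (x - s j)).toNNReal : ℝ≥0) : ℝ)

theorem shiftMax_nonneg {E ι : Type*} [Sub E] (φ : E → ℝ) (s : ι → E) (T : Finset ι) (x : E) :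
    0 ≤ shiftMax φ s T x := NNReal.coe_nonneg _

variable {E : Type*} [NormedAddCommGroup E] [MeasureSpace E] [BorelSpace E]
  [(volume : Measure E).IsAddHaarMeasure]

theorem integrable_shiftMax {ι : Type*} {φ : E → ℝ} (hφi : Integrable φ) (s : ι → E)
    (T : Finset ι) : Integrable (shiftMax φ s T) := by
  classical
  unfold shiftMax
  induction T using Finset.induction_on with
  | empty => simp
  | insert a T _ ih =>
    simp only [Finset.sup_insert, NNReal.coe_max, Real.coe_toNNReal']
    exact ((hφi.comp_sub_right (s a)).sup (integrable_zero _ _ _)).sup ih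

theorem lt_shiftMax_div_iff {S ι : Type*} [Sub S] {φ : S → ℝ} {s : ι → S} {T : Finset ι}
    {x : S} {y z : ℝ} (hy : 0 < y) (hz : 0 < z) :
    y < shiftMax φ s T x / z ↔ ∃ j ∈ T, z < φ (x - s j) / y := by
  have hyz : 0 < y * z := mul_pos hy hz
  have h1 : y < shiftMax φ s T x / z ↔ (y * z).toNNReal <
      T.sup fun j => (φ (x - s j)).toNNReal := by
    rw [lt_div_iff₀ hz, ← NNReal.coe_lt_coe, Real.coe_toNNReal _ hyz.le, shiftMax]
  rw [h1, Finset.lt_sup_iff]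
  refine exists_congr fun j => and_congr_right fun _ => ?_
  rw [← NNReal.coe_lt_coe, Real.coe_toNNReal _ hyz.le, Real.coe_toNNReal', lt_div_iff₀ hy,
    lt_max_iff]
  constructor
  · rintro (h | h)
    · linarith
    · linarith
  · intro h; left; linarith

/-- The joint distribution function of the moving maximum process is a void probability of the
underlying Poisson process. -/
theorem prob_movingMaximum_le {Ω ι : Type*} [MeasurableSpace Ω] {P : Measure Ω} {φ : E → ℝ}
    (hφ : Measurable φ) (hφi : Integrable φ) {Z : Ω → E → ℝ} (h : IsMovingMaximum P φ Z)
    (s : ι → E) (T : Finset ι) {z : ℝ} (hz : 0 < z) :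
    P.real {ω | ∀ j ∈ T, Z ω (s j) ≤ z} = Real.exp (-((∫ x, shiftMax φ s T x) / z)) := by
  obtain ⟨x, y, hP, hZ⟩ := h
  set A : Set (E × ℝ) := {p | ∃ j ∈ T, z < φ (p.1 - s j) / p.2} with hA
  have hAm : MeasurableSet A := by
    have : A = ⋃ j ∈ T, {p : E × ℝ | z < φ (p.1 - s j) / p.2} := by ext; simp [hA]
    rw [this]
    refine T.measurableSet_biUnion fun j _ => measurableSet_lt measurable_const ?_
    exact (hφ.comp (measurable_fst.sub_const _)).div measurable_snd
  have hΛ : ((volume : Measure E).prod ((volume : Measure ℝ).restrict (Ioi 0))) A =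
      ENNReal.ofReal ((∫ x, shiftMax φ s T x) / z) := by
    rw [Measure.prod_apply hAm, ← integral_div, ofReal_integral_eq_lintegral_ofReal
      ((integrable_shiftMax hφi s T).div_const z)
      (ae_of_all _ fun x => div_nonneg (shiftMax_nonneg _ _ _ _) hz.le)]
    refine lintegral_congr fun u => ?_
    rw [Measure.restrict_apply (measurable_prodMk_left hAm)]
    have : Prod.mk u ⁻¹' A ∩ Ioi 0 = Ioo 0 (shiftMax φ s T u / z) := by
      ext v
      simp only [mem_inter_iff, mem_preimage, mem_Ioi, mem_Ioo, hA, mem_ofPred_eq]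
      constructor
      · rintro ⟨h1, h2⟩; exact ⟨h2, (lt_shiftMax_div_iff h2 hz).2 h1⟩
      · rintro ⟨h1, h2⟩; exact ⟨(lt_shiftMax_div_iff h1 hz).1 h2, h1⟩
    rw [this, Real.volume_Ioo, sub_zero]
  have hvoid := hP.poisson A hAm (by rw [hΛ]; exact ENNReal.ofReal_ne_top) 0
  have hae : {ω | ∀ j ∈ T, Z ω (s j) ≤ z} =ᵐ[P]
      {ω | pointCount (fun j ω => (x j ω, y j ω)) A ω = ((0 : ℕ) : ℕ∞)} := by
    filter_upwards [hZ] with ω hω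
    refine propext ?_
    change (∀ j ∈ T, Z ω (s j) ≤ z) ↔ pointCount (fun j ω => (x j ω, y j ω)) A ω = ((0 : ℕ) : ℕ∞)
    rw [pointCount, Nat.cast_zero, encard_eq_zero, eq_empty_iff_forall_notMem]
    simp only [hA, mem_ofPred_eq, not_exists, not_and, not_lt]
    constructor
    · intro h i j hj
      exact ((hω (s j)).2 ⟨i, rfl⟩).trans (h j hj)
    · intro h j hj
      obtain ⟨i, hi⟩ := (hω (s j)).1
      rw [← hi]
      exact h i j hj
  rw [measureReal_congr hae, measureReal_def, hvoid, hΛ, poissonMeasure_singleton]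
  have h0 : 0 ≤ (∫ x, shiftMax φ s T x) / z :=
    div_nonneg (integral_nonneg fun x => shiftMax_nonneg _ _ _ _) hz.le
  simp only [pow_zero, mul_one, Nat.factorial_zero, Nat.cast_one, div_one]
  rw [ENNReal.toReal_ofReal (Real.exp_pos _).le]
  congr 2
  exact ENNReal.toReal_ofReal h0

/-- The inverse of `standardize γ` at `z > 0`. -/
noncomputable def destandardize (γ z : ℝ) : ℝ := if γ = 0 then Real.log z else (z ^ γ - 1) / γ

/-- For `γ < 0` the value `standardize γ w = 0` also occurs beyond the upper end point `-1 / γ`,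
whence the positivity assumption. -/
theorem standardize_le_iff {γ w z : ℝ} (hz : 0 < z) (hw : 0 < standardize γ w) :
    standardize γ w ≤ z ↔ w ≤ destandardize γ z := by
  unfold standardize at *
  unfold destandardize
  rcases eq_or_ne γ 0 with hγ | hγ
  · simp only [hγ, if_true]
    exact (Real.le_log_iff_exp_le hz).symm
  · simp only [hγ, if_false] at *
    have hpos : 0 < 1 + γ * w := by
      by_contra! hcon
      rw [max_eq_right hcon, Real.zero_rpow (by simpa using hγ)] at hw
      exact lt_irrefl _ hw
    rw [max_eq_left hpos.le]
    have hzγ : z = (z ^ γ) ^ (1 / γ) := by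
      rw [← Real.rpow_mul hz.le, mul_one_div_cancel hγ, Real.rpow_one]
    have hzp : 0 < z ^ γ := Real.rpow_pos_of_pos hz _
    rcases lt_or_gt_of_ne hγ with h | h
    · rw [le_div_iff_of_neg h]
      conv_lhs => rw [hzγ]
      rw [Real.rpow_le_rpow_iff_of_neg hpos hzp (by simpa using h)]
      constructor <;> intro <;> linarith
    · rw [le_div_iff₀ h]
      conv_lhs => rw [hzγ]
      rw [Real.rpow_le_rpow_iff hpos.le hzp.le (by simpa using h)]
      constructor <;> intro <;> linarith

theorem integral_shiftMax_singleton {ι : Type*} {φ : E → ℝ} (hφ0 : ∀ x, 0 ≤ φ x) (s : ι → E)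
    (j : ι) : ∫ x, shiftMax φ s {j} x = ∫ x, φ x := by
  simp only [shiftMax, Finset.sup_singleton, Real.coe_toNNReal _ (hφ0 _)]
  exact integral_sub_right_eq_self φ (s j)

/-- `P (Z t ≤ 0) ≤ P (Z t ≤ z) = exp (-1 / z)` for all `z > 0`, and the right side tends to zero. -/
theorem ae_movingMaximum_pos {Ω : Type*} [MeasurableSpace Ω] {P : Measure Ω}
    [IsProbabilityMeasure P] {φ : E → ℝ} (hφ : Measurable φ) (hφ0 : ∀ x, 0 ≤ φ x)
    (hφ1 : ∫ x, φ x = 1) {Z : Ω → E → ℝ} (h : IsMovingMaximum P φ Z) (t : E) :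
    ∀ᵐ ω ∂P, 0 < Z ω t := by
  have hφi : Integrable φ := by
    by_contra hc; rw [integral_undef hc] at hφ1; exact zero_ne_one hφ1
  have key : ∀ z : ℝ, 0 < z → P.real {ω | Z ω t ≤ 0} ≤ Real.exp (-(1 / z)) := by
    intro z hz
    have := prob_movingMaximum_le hφ hφi h (fun _ : Unit => t) {()} hz
    rw [integral_shiftMax_singleton hφ0, hφ1] at this
    rw [← this]
    refine measureReal_mono ?_
    intro ω hω
    have h0 : Z ω t ≤ 0 := hω
    simpa using h0.trans hz.le
  have hlim : Tendsto (fun z : ℝ => Real.exp (-(1 / z))) (𝓝[>] 0) (𝓝 0) := by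
    refine Real.tendsto_exp_atBot.comp (tendsto_neg_atTop_atBot.comp ?_)
    change Tendsto (fun z : ℝ => 1 / z) _ _
    simpa only [one_div] using tendsto_inv_nhdsGT_zero (𝕜 := ℝ)
  have h0 : P.real {ω | Z ω t ≤ 0} ≤ 0 :=
    ge_of_tendsto hlim (by filter_upwards [self_mem_nhdsWithin] with z hz using key z hz)
  have h1 : P {ω | Z ω t ≤ 0} = 0 := by
    rw [← measureReal_eq_zero_iff]; exact le_antisymm h0 measureReal_nonneg
  rw [ae_iff]
  simpa using h1

/-- The joint distribution function of the limit process at the levels that correspond to a common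
level `z` of its standardization. -/
theorem prob_limit_le {Ω ι : Type*} [MeasurableSpace Ω] {P : Measure Ω} [IsProbabilityMeasure P]
    {φ : E → ℝ} (hφ : Measurable φ) (hφ0 : ∀ x, 0 ≤ φ x) (hφ1 : ∫ x, φ x = 1)
    {Zt : Ω → C(E, ℝ)} {γ : C(E, ℝ)}
    (h : IsMovingMaximum P φ fun ω t => standardize (γ t) (Zt ω t))
    (s : ι → E) (T : Finset ι) {z : ℝ} (hz : 0 < z) :
    P.real {ω | ∀ j ∈ T, Zt ω (s j) ≤ destandardize (γ (s j)) z} =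
      Real.exp (-((∫ x, shiftMax φ s T x) / z)) := by
  have hφi : Integrable φ := by
    by_contra hc; rw [integral_undef hc] at hφ1; exact zero_ne_one hφ1
  rw [← prob_movingMaximum_le hφ hφi h s T hz]
  refine measureReal_congr ?_
  have hpos : ∀ᵐ ω ∂P, ∀ j ∈ T, 0 < standardize (γ (s j)) (Zt ω (s j)) :=
    (Finset.eventually_all T).2 fun j _ => ae_movingMaximum_pos hφ hφ0 hφ1 h (s j)
  filter_upwards [hpos] with ω hω
  refine propext (forall₂_congr fun j hj => ?_)
  exact (standardize_le_iff hz (hω j hj)).symm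

theorem destandardize_lt {γ z z' : ℝ} (hz : 0 < z) (hzz : z < z') :
    destandardize γ z < destandardize γ z' := by
  unfold destandardize
  split_ifs with h
  · exact Real.log_lt_log hz hzz
  · rcases lt_or_gt_of_ne h with h | h
    · rw [div_lt_div_right_of_neg h]
      have := Real.rpow_lt_rpow_of_neg hz hzz h
      linarith
    · rw [div_lt_div_iff_of_pos_right h]
      have := Real.rpow_lt_rpow hz.le hzz h
      linarith

/-- The marginal distributions of the limit process have no atoms in the interior of their support,
since the Fréchet distribution function `exp (-1 / z)` is continuous. -/
theorem prob_limit_eq {Ω : Type*} [MeasurableSpace Ω] {P : Measure Ω} [IsProbabilityMeasure P]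
    {φ : E → ℝ} (hφ : Measurable φ) (hφ0 : ∀ x, 0 ≤ φ x) (hφ1 : ∫ x, φ x = 1)
    {Zt : Ω → C(E, ℝ)} {γ : C(E, ℝ)}
    (h : IsMovingMaximum P φ fun ω t => standardize (γ t) (Zt ω t)) (t : E)
    (hm : AEMeasurable (fun ω => Zt ω t) P) {z : ℝ} (hz : 0 < z) :
    P {ω | Zt ω t = destandardize (γ t) z} = 0 := by
  have hcdf : ∀ z : ℝ, 0 < z →
      P.real {ω | Zt ω t ≤ destandardize (γ t) z} = Real.exp (-(1 / z)) := by
    intro z hz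
    have := prob_limit_le hφ hφ0 hφ1 h (fun _ : Unit => t) {()} hz
    rw [integral_shiftMax_singleton hφ0, hφ1] at this
    simpa using this
  have key : ∀ z' ∈ Ioo 0 z, P.real {ω | Zt ω t = destandardize (γ t) z} ≤
      Real.exp (-(1 / z)) - Real.exp (-(1 / z')) := by
    intro z' hz'
    rw [← hcdf z hz, ← hcdf z' hz'.1]
    have hdisj : Disjoint {ω | Zt ω t = destandardize (γ t) z}
        {ω | Zt ω t ≤ destandardize (γ t) z'} := by
      rw [Set.disjoint_left]
      intro ω h1 h2
      rw [mem_ofPred_eq] at h1 h2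
      exact absurd (destandardize_lt (γ := γ t) hz'.1 hz'.2) (not_lt.2 (h1 ▸ h2))
    rw [le_sub_iff_add_le, ← measureReal_union₀ (nullMeasurableSet_le hm aemeasurable_const)
      hdisj.aedisjoint]
    refine measureReal_mono ?_
    rintro ω (h1 | h1)
    · exact le_of_eq h1
    · exact le_trans h1 (destandardize_lt hz'.1 hz'.2).le
  have hlim : Tendsto (fun z' => Real.exp (-(1 / z)) - Real.exp (-(1 / z'))) (𝓝[<] z) (𝓝 0) := by
    have : ContinuousAt (fun z' => Real.exp (-(1 / z)) - Real.exp (-(1 / z'))) z := by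
      have := hz.ne'
      fun_prop (disch := assumption)
    have h2 := this.tendsto.mono_left (nhdsWithin_le_nhds (s := Iio z))
    simpa using h2
  have h0 : P.real {ω | Zt ω t = destandardize (γ t) z} ≤ 0 :=
    ge_of_tendsto hlim (by filter_upwards [Ioo_mem_nhdsLT hz] with z' hz' using key z' hz')
  rw [← measureReal_eq_zero_iff]
  exact le_antisymm h0 measureReal_nonneg

/-! ### Tails of the observations -/

theorem normalizedMax_le_iff {S : Type*} [TopologicalSpace S] (n : ℕ)
    (x : ℕ → C(S, ℝ)) (a b : C(S, ℝ)) (ha : ∀ t, 0 < a t)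
    (t : S) (w : ℝ) :
    normalizedMax n x a b ha t ≤ w ↔ ∀ i ∈ Finset.range (n + 1), x i t ≤ b t + a t * w := by
  change (_ - b t) / a t ≤ w ↔ _
  rw [div_le_iff₀ (ha t), sub_le_iff_le_add, Finset.sup'_le_iff]
  refine forall₂_congr fun i _ => ?_
  rw [mul_comm w, add_comm]

theorem measurable_eval {S : Type*} [TopologicalSpace S] (t : S) :
    Measurable fun x : C(S, ℝ) => x t :=
  (continuous_eval_const t).measurable

theorem prob_normalizedMax_le {S Ω ι : Type*} [TopologicalSpace S] [MeasurableSpace Ω]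
    {P : Measure Ω}
    {X : ℕ → Ω → C(S, ℝ)} (hi : iIndepFun X P)
    (hid : ∀ i, IdentDistrib (X i) (X 0) P P) (n : ℕ) (a b : C(S, ℝ)) (ha : ∀ t, 0 < a t)
    (s : ι → S) (T : Finset ι) (w : ι → ℝ) :
    P.real {ω | ∀ j ∈ T, normalizedMax n (fun i => X i ω) a b ha (s j) ≤ w j} =
      P.real {ω | ∀ j ∈ T, X 0 ω (s j) ≤ b (s j) + a (s j) * w j} ^ (n + 1) := by
  set B : Set C(S, ℝ) := {x | ∀ j ∈ T, x (s j) ≤ b (s j) + a (s j) * w j} with hB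
  have hBm : MeasurableSet B := by
    have : B = ⋂ j ∈ T, {x : C(S, ℝ) | x (s j) ≤ b (s j) + a (s j) * w j} := by ext; simp [hB]
    rw [this]
    exact T.measurableSet_biInter fun j _ => measurableSet_le (measurable_eval _) measurable_const
  have h1 : {ω | ∀ j ∈ T, normalizedMax n (fun i => X i ω) a b ha (s j) ≤ w j} =
      ⋂ i ∈ Finset.range (n + 1), X i ⁻¹' B := by
    ext ω
    simp only [normalizedMax_le_iff, mem_ofPred_eq, mem_iInter, mem_preimage, hB]
    exact ⟨fun h i hi j hj => h j hj i hi, fun h j hj i hi => h i hi j hj⟩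
  rw [measureReal_def, h1, hi.meas_biInter fun i _ => ⟨B, hBm, rfl⟩,
    Finset.prod_congr rfl fun i _ => (hid i).measure_preimage_eq hBm]
  simp [measureReal_def, hB]

/-- There are levels `u j n`, not depending on `T`, for which the maximum of `n + 1` observations
stays below them at the sites `s j`, `j ∈ T`, with asymptotic probability `P (Z (s j) ≤ z, j ∈ T)`.
Taking logarithms gives the limit of the exceedance probabilities. -/
theorem tendsto_tail {Ω Ω' ι : Type*} [MeasurableSpace Ω] [MeasurableSpace Ω'] [Fintype ι]
    {P : Measure Ω} [IsProbabilityMeasure P] {P' : Measure Ω'} [IsProbabilityMeasure P']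
    {φ : E → ℝ} (hφ : Measurable φ) (hφ0 : ∀ x, 0 ≤ φ x) (hφ1 : ∫ x, φ x = 1)
    {X : ℕ → Ω → C(E, ℝ)} {Zt : Ω' → C(E, ℝ)} (hX : MaximaConverge P X P' Zt)
    (hZ : IsModelLimit P' φ Zt) (s : ι → E) {z : ℝ} (hz : 0 < z) :
    ∃ u : ι → ℕ → ℝ, ∀ T : Finset ι,
      Tendsto (fun n : ℕ => ((n : ℝ) + 1) * P.real {ω | ∃ j ∈ T, u j n < X 0 ω (s j)}) atTop
        (𝓝 ((∫ x, shiftMax φ s T x) / z)) := by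
  obtain ⟨a, b, ha, hconv⟩ := hX.conv
  obtain ⟨γ, hγ⟩ := hZ
  set w : ι → ℝ := fun j => destandardize (γ (s j)) z with hw
  refine ⟨fun j n => b n (s j) + a n (s j) * w j, fun T => ?_⟩
  have hev : Continuous fun x : C(E, ℝ) => fun j : ι => x (s j) :=
    continuous_pi fun j => continuous_eval_const (s j)
  have hfd := hconv.continuous_comp hev
  have hB : IsClosed {x : ι → ℝ | ∀ j ∈ T, x j ≤ w j} := by
    have : {x : ι → ℝ | ∀ j ∈ T, x j ≤ w j} = ⋂ j ∈ T, {x : ι → ℝ | x j ≤ w j} := by ext; simp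
    rw [this]
    exact isClosed_biInter fun j _ => isClosed_le (continuous_apply j) continuous_const
  have hfr : frontier {x : ι → ℝ | ∀ j ∈ T, x j ≤ w j} ⊆ ⋃ j, {x : ι → ℝ | x j = w j} := by
    intro x hx
    by_contra hcon
    simp only [mem_iUnion, mem_ofPred_eq, not_exists] at hcon
    rw [hB.frontier_eq] at hx
    refine hx.2 (mem_interior.2 ⟨⋂ j ∈ T, {x : ι → ℝ | x j < w j}, ?_, ?_, ?_⟩)
    · intro y hy j hj
      simp only [mem_iInter, mem_ofPred_eq] at hy
      exact (hy j hj).le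
    · exact isOpen_biInter_finset fun j _ => isOpen_lt (continuous_apply j) continuous_const
    · simp only [mem_iInter, mem_ofPred_eq]
      exact fun j hj => lt_of_le_of_ne (hx.1 j hj) (hcon j)
  have hmeas : ∀ j, AEMeasurable (fun ω => Zt ω (s j)) P' := fun j =>
    (measurable_eval (s j)).comp_aemeasurable hconv.aemeasurable_limit
  have hnull : P'.map (fun ω => (fun j => Zt ω (s j) : ι → ℝ))
      (frontier {x : ι → ℝ | ∀ j ∈ T, x j ≤ w j}) = 0 := by
    refine measure_mono_null hfr ((measure_iUnion_null_iff).2 fun j => ?_)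
    rw [Measure.map_apply_of_aemeasurable (aemeasurable_pi_lambda _ hmeas)
      (measurableSet_eq_fun (measurable_pi_apply j) measurable_const)]
    exact prob_limit_eq hφ hφ0 hφ1 hγ (s j) (hmeas j) hz
  have hlim := ProbabilityMeasure.tendsto_measure_of_null_frontier_of_tendsto' hfd.tendsto hnull
  have hfin : (P'.map ((fun x j => x (s j)) ∘ Zt)) {x : ι → ℝ | ∀ j ∈ T, x j ≤ w j} ≠ ⊤ :=
    measure_ne_top _ _
  have hlim' := (ENNReal.tendsto_toReal hfin).comp hlim
  have hBm := hB.measurableSet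
  have hpow : Tendsto (fun n => P.real
      {ω | ∀ j ∈ T, X 0 ω (s j) ≤ b n (s j) + a n (s j) * w j} ^ (n + 1)) atTop
      (𝓝 (Real.exp (-((∫ x, shiftMax φ s T x) / z)))) := by
    rw [← prob_limit_le hφ hφ0 hφ1 hγ s T hz]
    refine Tendsto.congr (fun n => ?_) (hlim'.trans_eq ?_)
    · rw [← prob_normalizedMax_le hX.indep hX.ident n (a n) (b n) (ha n) s T w]
      simp only [Function.comp, ProbabilityMeasure.coe_mk]
      rw [Measure.map_apply_of_aemeasurable (hfd.forall_aemeasurable n) hBm]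
      rfl
    · rw [Measure.map_apply_of_aemeasurable hfd.aemeasurable_limit hBm]
      rfl
  refine (tendsto_mul_one_sub_of_tendsto_pow (fun n => measureReal_nonneg) hpow).congr fun n => ?_
  have hset : MeasurableSet {ω | ∀ j ∈ T, X 0 ω (s j) ≤ b n (s j) + a n (s j) * w j} := by
    have : {ω | ∀ j ∈ T, X 0 ω (s j) ≤ b n (s j) + a n (s j) * w j} =
        ⋂ j ∈ T, {ω | X 0 ω (s j) ≤ b n (s j) + a n (s j) * w j} := by ext; simp
    rw [this]
    exact T.measurableSet_biInter fun j _ =>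
      measurableSet_le ((measurable_eval _).comp (hX.measurable 0)) measurable_const
  rw [← probReal_compl_eq_one_sub hset]
  congr 2
  ext ω
  simp

end

/-! ### Empirical tail dependence -/

/-- Convergence in probability to a constant, split into two one-sided statements. -/
theorem weaklyConsistent_iff {Ω : Type*} [MeasurableSpace Ω] {P : Measure Ω}
    {T : ℕ → Ω → ℝ} {θ : ℝ} :
    WeaklyConsistent P T θ ↔ (∀ c, θ < c → Tendsto (fun n => P {ω | c ≤ T n ω}) atTop (𝓝 0)) ∧
      ∀ c, c < θ → Tendsto (fun n => P {ω | T n ω ≤ c}) atTop (𝓝 0) := by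
  unfold WeaklyConsistent
  simp only [tendstoInMeasure_iff_norm, Real.norm_eq_abs]
  constructor
  · intro h
    constructor <;> intro c hc
    · refine tendsto_of_tendsto_of_tendsto_of_le_of_le tendsto_const_nhds (h (c - θ) (by linarith))
        (fun _ => zero_le) fun n => measure_mono fun ω (hω : c ≤ T n ω) => ?_
      exact le_trans (sub_le_sub_right hω θ) (le_abs_self _)
    · refine tendsto_of_tendsto_of_tendsto_of_le_of_le tendsto_const_nhds (h (θ - c) (by linarith))
        (fun _ => zero_le) fun n => measure_mono fun ω (hω : T n ω ≤ c) => ?_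
      exact le_trans (by linarith [show T n ω ≤ c from hω] : θ - c ≤ -(T n ω - θ)) (neg_le_abs _)
  · rintro ⟨h1, h2⟩ ε hε
    have hsum := (h1 (θ + ε) (by linarith)).add (h2 (θ - ε) (by linarith))
    rw [add_zero] at hsum
    refine tendsto_of_tendsto_of_tendsto_of_le_of_le tendsto_const_nhds hsum
      (fun _ => zero_le) fun n => (measure_mono fun ω (hω : ε ≤ |T n ω - θ|) => ?_).trans
        (measure_union_le _ _)
    rcases le_abs.1 hω with h | h
    · left; exact (by linarith : θ + ε ≤ T n ω)
    · right; exact (by linarith : T n ω ≤ θ - ε)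

theorem ncard_fin_eq_sum_indicator {α : Type*} (n : ℕ) (x : ℕ → α) (A : Set α) :
    ({i : Fin n | x i ∈ A}.ncard : ℝ) =
      ∑ i ∈ Finset.range n, A.indicator (fun _ => (1 : ℝ)) (x i) := by
  classical
  rw [← Fin.sum_univ_eq_sum_range (fun i => A.indicator (fun _ => (1 : ℝ)) (x i)) n]
  rw [show {i : Fin n | x i ∈ A} = ((Finset.univ.filter fun i : Fin n => x i ∈ A) : Set (Fin n)) by
    ext; simp, ncard_coe_finset, Finset.card_filter]
  push_cast
  exact Finset.sum_congr rfl fun i _ => by simp [Set.indicator_apply]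

/-- A law of large numbers for rare events: if `(n / k) P (X ∈ A n) → ℓ` with `k → ∞`, then the
number of visits to `A n` divided by `k` tends to `ℓ`, by Chebyshev's inequality. -/
theorem weaklyConsistent_ncard_div {Ω α : Type*} [MeasurableSpace Ω] [MeasurableSpace α]
    {P : Measure Ω} [IsProbabilityMeasure P] {X : ℕ → Ω → α} (hm : ∀ i, Measurable (X i))
    (hi : iIndepFun X P) (hid : ∀ i, IdentDistrib (X i) (X 0) P P) {k : ℕ → ℕ}
    (hk : Tendsto k atTop atTop) {A : ℕ → Set α} (hA : ∀ n, MeasurableSet (A n)) {l : ℝ}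
    (hl : Tendsto (fun n : ℕ => (n : ℝ) / k n * P.real (X 0 ⁻¹' A n)) atTop (𝓝 l)) :
    WeaklyConsistent P (fun n ω => 1 / (k n : ℝ) * ({i : Fin n | X i ω ∈ A n}.ncard : ℝ)) l := by
  set g : ℕ → α → ℝ := fun n => (A n).indicator fun _ => 1 with hg
  have hgm : ∀ n, Measurable (g n) := fun n => measurable_const.indicator (hA n)
  have hg0 : ∀ n x, 0 ≤ g n x := fun n x => indicator_nonneg (fun _ _ => zero_le_one) _
  have hg1 : ∀ n x, g n x ≤ 1 := fun n x => indicator_le_self' (fun _ _ => zero_le_one) x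
  have hLp : ∀ n i, MemLp (fun ω => g n (X i ω)) 2 P := fun n i =>
    MemLp.of_bound ((hgm n).comp (hm i)).aestronglyMeasurable 1
      (ae_of_all _ fun ω => by rw [Real.norm_eq_abs, abs_of_nonneg (hg0 _ _)]; exact hg1 _ _)
  have hmean : ∀ n i, ∫ ω, g n (X i ω) ∂P = P.real (X 0 ⁻¹' A n) := by
    intro n i
    have h1 : (fun ω => g n (X i ω)) = (X i ⁻¹' A n).indicator fun _ => 1 := rfl
    rw [h1, integral_indicator_const _ (hm i (hA n)), smul_eq_mul, mul_one, measureReal_def,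
      (hid i).measure_preimage_eq (hA n), measureReal_def]
  have hvar : ∀ n i, variance (fun ω => g n (X i ω)) P ≤ P.real (X 0 ⁻¹' A n) := by
    intro n i
    refine (variance_le_expectation_sq ((hgm n).comp (hm i)).aestronglyMeasurable).trans_eq ?_
    rw [← hmean n i]
    refine integral_congr_ae (ae_of_all _ fun ω => ?_)
    by_cases h : X i ω ∈ A n <;> simp [hg, h]
  set S : ℕ → Ω → ℝ := fun n => ∑ i ∈ Finset.range n, fun ω => g n (X i ω) with hS
  have hSLp : ∀ n, MemLp (S n) 2 P := fun n => memLp_finsetSum' _ fun i _ => hLp n i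
  have hSmean : ∀ n, ∫ ω, S n ω ∂P = n * P.real (X 0 ⁻¹' A n) := by
    intro n
    simp only [hS, Finset.sum_apply]
    rw [integral_finsetSum _ fun i _ => (hLp n i).integrable one_le_two]
    simp [hmean]
  have hSvar : ∀ n, variance (S n) P ≤ n * P.real (X 0 ⁻¹' A n) := by
    intro n
    rw [hS, IndepFun.variance_sum (fun i _ => hLp n i)
      fun i _ j _ hij => (hi.indepFun hij).comp (hgm n) (hgm n)]
    refine (Finset.sum_le_sum fun i _ => hvar n i).trans_eq ?_
    simp
  have hcount : ∀ n ω, ({i : Fin n | X i ω ∈ A n}.ncard : ℝ) = S n ω := fun n ω => by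
    simpa [hS, Finset.sum_apply] using ncard_fin_eq_sum_indicator n (fun i => X i ω) (A n)
  unfold WeaklyConsistent
  simp only [tendstoInMeasure_iff_norm, Real.norm_eq_abs, hcount]
  intro ε hε
  have hk' : Tendsto (fun n => (k n : ℝ)) atTop atTop := tendsto_natCast_atTop_atTop.comp hk
  have hbound : Tendsto (fun n : ℕ => ENNReal.ofReal
      ((n : ℝ) / k n * P.real (X 0 ⁻¹' A n) * (4 / ε ^ 2) * (k n : ℝ)⁻¹)) atTop (𝓝 0) := by
    have := (hl.mul_const (4 / ε ^ 2)).mul (tendsto_inv_atTop_zero.comp hk')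
    rw [mul_zero] at this
    simpa using ENNReal.tendsto_ofReal this
  refine tendsto_of_tendsto_of_tendsto_of_le_of_le' tendsto_const_nhds hbound
    (Eventually.of_forall fun _ => zero_le) ?_
  filter_upwards [hk'.eventually_gt_atTop 0, Metric.tendsto_nhds.1 hl (ε / 2) (by linarith)]
    with n hkn hn
  rw [Real.dist_eq] at hn
  have hc : 0 < (k n : ℝ) * (ε / 2) := by positivity
  refine (measure_mono ?_).trans
    ((meas_ge_le_variance_div_sq (hSLp n) hc).trans (ENNReal.ofReal_le_ofReal ?_))
  · intro ω hω
    rw [mem_ofPred_eq] at hω ⊢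
    rw [hSmean]
    have h1 : 1 / (k n : ℝ) * S n ω - l = (S n ω - n * P.real (X 0 ⁻¹' A n)) / k n +
        ((n : ℝ) / k n * P.real (X 0 ⁻¹' A n) - l) := by field_simp; ring
    rw [h1] at hω
    have h2 := hω.trans (abs_add_le _ _)
    rw [abs_div, abs_of_pos hkn] at h2
    have h3 : ε / 2 ≤ |S n ω - n * P.real (X 0 ⁻¹' A n)| / k n := by linarith
    rw [le_div_iff₀ hkn] at h3
    linarith
  · refine (div_le_div_of_nonneg_right (hSvar n) (by positivity)).trans_eq ?_
    field_simp
    norm_num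

/-- The tail dependence coefficient `R (1, …, 1) = ∫ min_j φ (x - s j) dx` of the moving maximum
process at the sites `s j`. -/
noncomputable def tailDep {E ι : Type*} [MeasureSpace E] [Sub E] [Fintype ι] [Nonempty ι]
    (φ : E → ℝ) (s : ι → E) : ℝ :=
  ∫ x, Finset.univ.inf' Finset.univ_nonempty fun j => φ (x - s j)

theorem tailDep_pair {E : Type*} [MeasureSpace E] [Sub E] (φ : E → ℝ) (s t : E) :
    tailDep φ ![s, t] = ∫ x, min (φ (x - s)) (φ (x - t)) := by
  unfold tailDep
  refine integral_congr_ae (ae_of_all _ fun x => ?_)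
  apply le_antisymm
  · exact le_min (Finset.inf'_le _ (Finset.mem_univ (0 : Fin 2)))
      (Finset.inf'_le _ (Finset.mem_univ (1 : Fin 2)))
  · refine Finset.le_inf' _ _ fun j _ => ?_
    fin_cases j
    · exact min_le_left _ _
    · exact min_le_right _ _

section
variable {E : Type*} [NormedAddCommGroup E] [MeasureSpace E] [BorelSpace E]
  [(volume : Measure E).IsAddHaarMeasure]

open scoped NNReal in
/-- Levels of asymptotic tail probability `1 / (n z)` at each site, together with the limit of
their joint exceedance probability. -/
theorem exists_levels {Ω Ω' ι : Type*} [MeasurableSpace Ω] [MeasurableSpace Ω'] [Fintype ι]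
    [Nonempty ι] {P : Measure Ω} [IsProbabilityMeasure P] {P' : Measure Ω'}
    [IsProbabilityMeasure P'] {φ : E → ℝ} (hφ : Measurable φ) (hφ0 : ∀ x, 0 ≤ φ x)
    (hφ1 : ∫ x, φ x = 1) {X : ℕ → Ω → C(E, ℝ)} {Zt : Ω' → C(E, ℝ)}
    (hX : MaximaConverge P X P' Zt) (hZ : IsModelLimit P' φ Zt) (s : ι → E) {z : ℝ} (hz : 0 < z) :
    ∃ u : ι → ℕ → ℝ,
      (∀ j, Tendsto (fun n : ℕ => ((n : ℝ) + 1) * P.real {ω | u j n < X 0 ω (s j)}) atTop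
        (𝓝 (1 / z))) ∧
      Tendsto (fun n : ℕ => ((n : ℝ) + 1) * P.real {ω | ∀ j, u j n < X 0 ω (s j)}) atTop
        (𝓝 (tailDep φ s / z)) := by
  classical
  have hφi : Integrable φ := by
    by_contra hc; rw [integral_undef hc] at hφ1; exact zero_ne_one hφ1
  obtain ⟨u, hu⟩ := tendsto_tail hφ hφ0 hφ1 hX hZ s hz
  refine ⟨u, fun j => ?_, ?_⟩
  · have := hu {j}
    rw [integral_shiftMax_singleton hφ0, hφ1] at this
    simpa using this
  · have h := tendsto_measure_iInter_of_iUnion (P := P) (μ := volume)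
      (c := fun n => z * ((n : ℝ) + 1)) (A := fun j n => {ω | u j n < X 0 ω (s j)})
      (f := fun j x => (φ (x - s j)).toNNReal)
      (fun j n => measurableSet_lt measurable_const
        ((measurable_eval _).comp (hX.measurable 0)))
      (fun j => by
        simpa only [Real.coe_toNNReal _ (hφ0 _)] using hφi.comp_sub_right (s j))
      (fun T => by
        have := (hu T).const_mul z
        rw [mul_div_cancel₀ _ hz.ne'] at this
        simpa only [mul_assoc, shiftMax, mem_ofPred_eq] using this)
    have h2 : ∀ x, ((Finset.univ.inf' Finset.univ_nonempty
        fun j => (φ (x - s j)).toNNReal : ℝ≥0) : ℝ) =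
        Finset.univ.inf' Finset.univ_nonempty fun j => φ (x - s j) := by
      intro x
      rw [Finset.apply_inf'_eq_inf'_comp Finset.univ_nonempty ((↑) : ℝ≥0 → ℝ)
        fun a b => NNReal.coe_min a b]
      simp only [Function.comp_def, Real.coe_toNNReal _ (hφ0 _)]
    simp only [h2] at h
    refine (h.div_const z).congr fun n => ?_
    simp only [mem_ofPred_eq]
    field_simp

/-- The levels of sample size `n / k` are exceeded by about `k / z` of the first `n` observations
at each site, and by about `k R (1, …, 1) / z` of them at all sites. -/
theorem exists_levels_count {Ω Ω' ι : Type*} [MeasurableSpace Ω] [MeasurableSpace Ω'] [Fintype ι]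
    [Nonempty ι] {P : Measure Ω} [IsProbabilityMeasure P] {P' : Measure Ω'}
    [IsProbabilityMeasure P'] {φ : E → ℝ} (hφ : Measurable φ) (hφ0 : ∀ x, 0 ≤ φ x)
    (hφ1 : ∫ x, φ x = 1) {X : ℕ → Ω → C(E, ℝ)} {Zt : Ω' → C(E, ℝ)}
    (hX : MaximaConverge P X P' Zt) (hZ : IsModelLimit P' φ Zt) {k : ℕ → ℕ}
    (hk : Tendsto k atTop atTop) (hkn : Tendsto (fun n : ℕ => (k n : ℝ) / (n : ℝ)) atTop (𝓝 0))
    (s : ι → E) {z : ℝ} (hz : 0 < z) :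
    ∃ v : ι → ℕ → ℝ,
      (∀ j, WeaklyConsistent P (fun n ω => 1 / (k n : ℝ) *
        ({i : Fin n | v j n < X i ω (s j)}.ncard : ℝ)) (1 / z)) ∧
      WeaklyConsistent P (fun n ω => 1 / (k n : ℝ) *
        ({i : Fin n | ∀ j, v j n < X i ω (s j)}.ncard : ℝ)) (tailDep φ s / z) := by
  obtain ⟨u, hu1, hu2⟩ := exists_levels hφ hφ0 hφ1 hX hZ s hz
  have hk0 : ∀ᶠ n in atTop, 0 < (k n : ℝ) :=
    (tendsto_natCast_atTop_atTop.comp hk).eventually_gt_atTop 0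
  have hratio : Tendsto (fun n : ℕ => (n : ℝ) / k n) atTop atTop := by
    have h1 : Tendsto (fun n : ℕ => (k n : ℝ) / (n : ℝ)) atTop (𝓝[>] 0) :=
      tendsto_nhdsWithin_iff.2 ⟨hkn, by
        filter_upwards [hk0, eventually_gt_atTop 0] with n h1 h2
        have : (0 : ℝ) < n := by exact_mod_cast h2
        exact div_pos h1 this⟩
    refine (tendsto_inv_nhdsGT_zero.comp h1).congr fun n => ?_
    simp [Function.comp]
  have hblock : Tendsto (fun n => n / k n) atTop atTop := by
    have := (tendsto_nat_floor_atTop (α := ℝ)).comp hratio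
    refine this.congr fun n => ?_
    simp [Function.comp, Nat.floor_div_eq_div]
  have hone : Tendsto (fun n : ℕ => ((n : ℝ) / k n) / ((n / k n : ℕ) : ℝ)) atTop (𝓝 1) := by
    have := ((tendsto_nat_floor_div_atTop (R := ℝ)).comp hratio).inv₀ one_ne_zero
    rw [inv_one] at this
    refine this.congr fun n => ?_
    simp [Function.comp, Nat.floor_div_eq_div]
  -- The levels of sample size `N` have index `N - 1`.
  have hidx : Tendsto (fun n => n / k n - 1) atTop atTop := (tendsto_sub_atTop_nat 1).comp hblock
  have key : ∀ {q : ℕ → ℝ} {l : ℝ}, Tendsto (fun n : ℕ => ((n : ℝ) + 1) * q n) atTop (𝓝 l) →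
      Tendsto (fun n : ℕ => (n : ℝ) / k n * q (n / k n - 1)) atTop (𝓝 l) := by
    intro q l hq
    have := hone.mul (hq.comp hidx)
    rw [one_mul] at this
    refine this.congr' ?_
    filter_upwards [hblock.eventually_ge_atTop 1] with n hn
    have h1 : (((n / k n - 1 : ℕ) : ℝ) + 1) = ((n / k n : ℕ) : ℝ) := by
      exact_mod_cast congrArg (Nat.cast (R := ℝ)) (Nat.sub_add_cancel hn)
    have h2 : ((n / k n : ℕ) : ℝ) ≠ 0 := by positivity
    simp only [Function.comp, h1]
    field_simp
  refine ⟨fun j n => u j (n / k n - 1), fun j => ?_, ?_⟩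
  · exact weaklyConsistent_ncard_div hX.measurable hX.indep hX.ident hk
      (A := fun n => {x : C(E, ℝ) | u j (n / k n - 1) < x (s j)})
      (fun n => measurableSet_lt measurable_const (measurable_eval _)) (key (hu1 j))
  · refine weaklyConsistent_ncard_div hX.measurable hX.indep hX.ident hk
      (A := fun n => {x : C(E, ℝ) | ∀ j, u j (n / k n - 1) < x (s j)}) (fun n => ?_) (key hu2)
    rw [ofPred_forall]
    exact MeasurableSet.iInter fun j => measurableSet_lt measurable_const (measurable_eval _)

/-- The empirical tail dependence is sandwiched between the numbers of joint exceedances of the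
deterministic levels with `z < 1` and with `z > 1`, between which the random thresholds lie with
probability tending to one. -/
theorem weaklyConsistent_RHat {Ω Ω' ι : Type*} [MeasurableSpace Ω] [MeasurableSpace Ω']
    [Fintype ι] [Nonempty ι] {P : Measure Ω} [IsProbabilityMeasure P] {P' : Measure Ω'}
    [IsProbabilityMeasure P'] {φ : E → ℝ} (hφ : Measurable φ) (hφ0 : ∀ x, 0 ≤ φ x)
    (hφ1 : ∫ x, φ x = 1) {X : ℕ → Ω → C(E, ℝ)} {Zt : Ω' → C(E, ℝ)}
    (hX : MaximaConverge P X P' Zt) (hZ : IsModelLimit P' φ Zt) {k : ℕ → ℕ}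
    (hk : Tendsto k atTop atTop) (hkn : Tendsto (fun n : ℕ => (k n : ℝ) / (n : ℝ)) atTop (𝓝 0))
    (s : ι → E) :
    WeaklyConsistent P (fun n ω => RHat n (k n) (fun i => X i ω) s fun _ => 1)
      (tailDep φ s) := by
  have hev : ∀ᶠ n in atTop, 0 < k n ∧ k n ≤ n := by
    filter_upwards [hk.eventually_gt_atTop 0, eventually_gt_atTop 0,
      hkn.eventually (gt_mem_nhds zero_lt_one)] with n h1 h2 h3
    refine ⟨h1, ?_⟩
    have h4 : (0 : ℝ) < n := by exact_mod_cast h2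
    rw [div_lt_one h4] at h3
    exact_mod_cast h3.le
  have hcont : ContinuousAt (fun z : ℝ => tailDep φ s / z) 1 := by
    have := one_ne_zero (α := ℝ)
    fun_prop (disch := assumption)
  have hlim : Tendsto (fun z : ℝ => tailDep φ s / z) (𝓝 1) (𝓝 (tailDep φ s)) := by
    simpa using hcont.tendsto
  rw [weaklyConsistent_iff]
  constructor
  · intro c hc
    have hleft : ∀ᶠ z in 𝓝[<] (1 : ℝ), z ∈ Ioo (0 : ℝ) 1 := Ioo_mem_nhdsLT one_pos
    obtain ⟨z, ⟨hz0, hz1⟩, hzc⟩ := (hleft.and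
      (nhdsWithin_le_nhds (hlim.eventually (gt_mem_nhds hc)))).exists
    obtain ⟨v, hv1, hv2⟩ := exists_levels_count hφ hφ0 hφ1 hX hZ hk hkn s hz0
    have hsum := ((weaklyConsistent_iff.1 hv2).1 c hzc).add
      (tendsto_finsetSum Finset.univ fun j _ =>
        (weaklyConsistent_iff.1 (hv1 j)).2 1 (by rw [lt_div_iff₀ hz0]; linarith))
    rw [Finset.sum_const_zero, add_zero] at hsum
    refine tendsto_of_tendsto_of_tendsto_of_le_of_le' tendsto_const_nhds hsum
      (Eventually.of_forall fun _ => zero_le) ?_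
    filter_upwards [hev] with n ⟨hkp, hkl⟩
    refine (measure_mono (t := _ ∪ ⋃ j, _) ?_).trans ((measure_union_le _ _).trans
      (add_le_add le_rfl (measure_iUnion_fintype_le P _)))
    intro ω (hω : c ≤ RHat n (k n) (fun i => X i ω) s fun _ => 1)
    have hkR : (0 : ℝ) < k n := by exact_mod_cast hkp
    by_contra hcon
    simp only [mem_union, mem_iUnion, mem_ofPred_eq, not_or, not_exists, not_le] at hcon
    refine absurd hω (not_le.2 (lt_of_le_of_lt ?_ hcon.1))
    unfold RHat
    refine mul_le_mul_of_nonneg_left (Nat.cast_le.2 (ncard_le_ncard ?_ (toFinite _)))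
      (by positivity)
    intro i hi j
    refine lt_of_lt_of_le ?_ (hi j)
    rw [mul_one, Nat.floor_natCast]
    by_contra! hle
    have h1 := (orderStat_le_iff (fun l : Fin n => X l ω (s j)) hkp hkl _).1 hle
    have h2 := hcon.2 j
    rw [one_div_mul_eq_div, lt_div_iff₀ hkR, one_mul] at h2
    have h3 : ({i : Fin n | v j n < X i ω (s j)}.ncard : ℝ) < k n := by exact_mod_cast h1
    linarith
  · intro c hc
    have hright : ∀ᶠ z in 𝓝[>] (1 : ℝ), z ∈ Ioi (1 : ℝ) := self_mem_nhdsWithin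
    obtain ⟨z, hz1, hzc⟩ := (hright.and
      (nhdsWithin_le_nhds (hlim.eventually (lt_mem_nhds hc)))).exists
    have hz0 : 0 < z := one_pos.trans hz1
    obtain ⟨v, hv1, hv2⟩ := exists_levels_count hφ hφ0 hφ1 hX hZ hk hkn s hz0
    have hsum := ((weaklyConsistent_iff.1 hv2).2 c hzc).add
      (tendsto_finsetSum Finset.univ fun j _ =>
        (weaklyConsistent_iff.1 (hv1 j)).1 1 (by rw [div_lt_iff₀ hz0, one_mul]; exact hz1))
    rw [Finset.sum_const_zero, add_zero] at hsum
    refine tendsto_of_tendsto_of_tendsto_of_le_of_le' tendsto_const_nhds hsum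
      (Eventually.of_forall fun _ => zero_le) ?_
    filter_upwards [hev] with n ⟨hkp, hkl⟩
    refine (measure_mono (t := _ ∪ ⋃ j, _) ?_).trans ((measure_union_le _ _).trans
      (add_le_add le_rfl (measure_iUnion_fintype_le P _)))
    intro ω (hω : RHat n (k n) (fun i => X i ω) s (fun _ => 1) ≤ c)
    have hkR : (0 : ℝ) < k n := by exact_mod_cast hkp
    by_contra hcon
    simp only [mem_union, mem_iUnion, mem_ofPred_eq, not_or, not_exists, not_le] at hcon
    refine absurd hω (not_le.2 (lt_of_lt_of_le hcon.1 ?_))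
    unfold RHat
    refine mul_le_mul_of_nonneg_left (Nat.cast_le.2 (ncard_le_ncard ?_ (toFinite _)))
      (by positivity)
    intro i hi j
    refine le_trans ?_ (hi j).le
    rw [mul_one, Nat.floor_natCast]
    refine (orderStat_le_iff (fun l : Fin n => X l ω (s j)) hkp hkl _).2 ?_
    have h2 := hcon.2 j
    rw [one_div_mul_eq_div, div_lt_iff₀ hkR, one_mul] at h2
    exact_mod_cast h2

theorem RHatPair_eq {S : Type*} [TopologicalSpace S] (n k : ℕ) (X : ℕ → C(S, ℝ)) (s t : S) :
    RHatPair n k X s t = RHat n k X ![s, t] fun _ => 1 := by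
  unfold RHatPair
  congr 1
  ext i
  fin_cases i <;> rfl

end

/-! ### Tail dependence of densities with spherical symmetry -/

section
open scoped RealInnerProductSpace

variable {E : Type*} [NormedAddCommGroup E] [InnerProductSpace ℝ E] [FiniteDimensional ℝ E]
  [MeasurableSpace E] [BorelSpace E]

/-- A positive probability density that is a strictly decreasing function of the norm. -/
structure IsRadialDensity (φ₀ : E → ℝ) : Prop where
  measurable : Measurable φ₀
  pos : ∀ x, 0 < φ₀ x
  integral_eq_one : ∫ x, φ₀ x = 1
  lt_of_norm_lt : ∀ x y, ‖x‖ < ‖y‖ → φ₀ y < φ₀ x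
  eq_of_norm_eq : ∀ x y, ‖x‖ = ‖y‖ → φ₀ x = φ₀ y

/-- The integral of `φ₀` over the half-space of points whose component in the direction `e` is at
most `u`. -/
noncomputable def halfSpaceMass (φ₀ : E → ℝ) (e : E) (u : ℝ) : ℝ := ∫ x in {x | ⟪x, e⟫ ≤ u}, φ₀ x

variable {φ₀ : E → ℝ}

theorem IsRadialDensity.le_of_norm_le (h : IsRadialDensity φ₀) {x y : E} (hxy : ‖x‖ ≤ ‖y‖) :
    φ₀ y ≤ φ₀ x := by
  rcases hxy.lt_or_eq with h1 | h1
  · exact (h.lt_of_norm_lt x y h1).le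
  · exact (h.eq_of_norm_eq x y h1).ge

theorem IsRadialDensity.integrable (h : IsRadialDensity φ₀) : Integrable φ₀ := by
  by_contra hc
  have := h.integral_eq_one
  rw [integral_undef hc] at this
  exact zero_ne_one this

theorem measurableSet_inner_le (e : E) (u : ℝ) : MeasurableSet {x : E | ⟪x, e⟫ ≤ u} :=
  measurableSet_le (by fun_prop) measurable_const

theorem measurableSet_lt_inner (e : E) (u : ℝ) : MeasurableSet {x : E | u < ⟪x, e⟫} :=
  measurableSet_lt measurable_const (by fun_prop)

theorem IsRadialDensity.strictMono_halfSpaceMass (h : IsRadialDensity φ₀) {e : E} (he : ‖e‖ = 1) :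
    StrictMono (halfSpaceMass φ₀ e) := by
  intro u v huv
  have hdisj : Disjoint {x : E | ⟪x, e⟫ ≤ u} {x | u < ⟪x, e⟫ ∧ ⟪x, e⟫ ≤ v} := by
    rw [Set.disjoint_left]
    intro x (hx : ⟪x, e⟫ ≤ u) hx'
    exact absurd hx'.1 (not_lt.2 hx)
  have hm : MeasurableSet {x : E | u < ⟪x, e⟫ ∧ ⟪x, e⟫ ≤ v} :=
    (measurableSet_lt_inner e u).inter (measurableSet_inner_le e v)
  have hunion : {x : E | ⟪x, e⟫ ≤ v} = {x | ⟪x, e⟫ ≤ u} ∪ {x | u < ⟪x, e⟫ ∧ ⟪x, e⟫ ≤ v} := by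
    ext x
    simp only [mem_ofPred_eq, mem_union]
    constructor
    · intro hx
      rcases le_or_gt ⟪x, e⟫ u with h1 | h1
      · exact Or.inl h1
      · exact Or.inr ⟨h1, hx⟩
    · rintro (h1 | h1)
      · exact h1.trans huv.le
      · exact h1.2
  unfold halfSpaceMass
  rw [hunion, setIntegral_union hdisj hm h.integrable.integrableOn h.integrable.integrableOn]
  refine lt_add_of_pos_right _ ?_
  rw [setIntegral_pos_iff_support_of_nonneg_ae (ae_of_all _ fun x => (h.pos x).le)
    h.integrable.integrableOn]
  have hsupp : Function.support φ₀ = univ := by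
    ext x; simpa using (h.pos x).ne'
  rw [hsupp, univ_inter]
  have hopen : IsOpen {x : E | u < ⟪x, e⟫ ∧ ⟪x, e⟫ < v} :=
    (isOpen_lt continuous_const (g := fun x : E => ⟪x, e⟫) (by fun_prop)).inter
      (isOpen_lt (f := fun x : E => ⟪x, e⟫) (by fun_prop) continuous_const)
  refine (hopen.measure_pos volume ⟨((u + v) / 2) • e, ?_⟩).trans_le
    (measure_mono fun x hx => ⟨hx.1, hx.2.le⟩)
  have : ⟪((u + v) / 2) • e, e⟫ = (u + v) / 2 := by
    rw [real_inner_smul_left, real_inner_self_eq_norm_sq, he]; ring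
  rw [mem_ofPred_eq, this]
  constructor <;> linarith

theorem volume_inner_eq {e : E} (he : e ≠ 0) (u : ℝ) : volume {x : E | ⟪x, e⟫ = u} = 0 := by
  have hne : (ℝ ∙ e)ᗮ ≠ ⊤ := by
    intro htop
    have : e ∈ (ℝ ∙ e)ᗮ := htop ▸ Submodule.mem_top
    rw [Submodule.mem_orthogonal_singleton_iff_inner_right] at this
    exact he (inner_self_eq_zero.1 this)
  have hset : {x : E | ⟪x, e⟫ = u} =
      (fun x => x + -((u / ‖e‖ ^ 2) • e)) ⁻¹' ((ℝ ∙ e)ᗮ : Set E) := by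
    ext x
    have : ‖e‖ ^ 2 ≠ 0 := pow_ne_zero _ (norm_ne_zero_iff.2 he)
    rw [mem_preimage, SetLike.mem_coe, Submodule.mem_orthogonal_singleton_iff_inner_left,
      inner_add_left, inner_neg_left, real_inner_smul_left, real_inner_self_eq_norm_sq,
      div_mul_cancel₀ _ this, mem_ofPred_eq]
    constructor <;> intro <;> linarith
  rw [hset, measure_preimage_add_right]
  exact Measure.addHaar_submodule volume _ hne

/-- The mass of a half-space depends on its distance to the origin only: reflect in the hyperplane
that swaps the two normal vectors. -/
theorem IsRadialDensity.setIntegral_lt_inner (h : IsRadialDensity φ₀) {e : E} (he : ‖e‖ = 1)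
    {δ : E} (hδ : δ ≠ 0) :
    ∫ x in {x | ‖δ‖ ^ 2 / 2 < ⟪x, δ⟫}, φ₀ x = 1 - halfSpaceMass φ₀ e (‖δ‖ / 2) := by
  have hδ' : 0 < ‖δ‖ := norm_pos_iff.2 hδ
  have hnorm : ‖δ‖ = ‖‖δ‖ • e‖ := by rw [norm_smul, he, norm_norm, mul_one]
  set R : E ≃ₗᵢ[ℝ] E := (ℝ ∙ (δ - ‖δ‖ • e))ᗮ.reflection with hR
  have hRδ : R δ = ‖δ‖ • e := Submodule.reflection_sub hnorm
  have hpre : {x : E | ‖δ‖ ^ 2 / 2 < ⟪x, δ⟫} = R ⁻¹' {x | ‖δ‖ / 2 < ⟪x, e⟫} := by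
    ext x
    have h1 : ⟪x, δ⟫ = ‖δ‖ * ⟪R x, e⟫ := by
      rw [← R.inner_map_map x δ, hRδ, real_inner_smul_right]
    rw [mem_preimage, mem_ofPred_eq, mem_ofPred_eq, h1]
    constructor <;> intro h2 <;> nlinarith
  have hφR : ∀ x, φ₀ x = φ₀ (R x) := fun x => h.eq_of_norm_eq _ _ (R.norm_map x).symm
  have h1 : ∫ x in {x | ‖δ‖ ^ 2 / 2 < ⟪x, δ⟫}, φ₀ x =
      ∫ x in {x | ‖δ‖ / 2 < ⟪x, e⟫}, φ₀ x := by
    refine Eq.trans ?_ (R.measurePreserving.setIntegral_preimage_emb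
      R.toHomeomorph.measurableEmbedding φ₀ {x | ‖δ‖ / 2 < ⟪x, e⟫})
    rw [hpre]
    exact setIntegral_congr_fun (R.continuous.measurable (measurableSet_lt_inner e _))
      fun x _ => hφR x
  have h2 : {x : E | ‖δ‖ / 2 < ⟪x, e⟫} = {x | ⟪x, e⟫ ≤ ‖δ‖ / 2}ᶜ := by
    ext x; simp
  rw [h1, h2, halfSpaceMass, ← h.integral_eq_one,
    ← integral_add_compl (measurableSet_inner_le e (‖δ‖ / 2)) h.integrable]
  ring

/-- The mass common to two shifts of a radial density is carried in equal parts by the two sides of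
the perpendicular bisector of the sites. -/
theorem IsRadialDensity.integral_min (h : IsRadialDensity φ₀) {e : E} (he : ‖e‖ = 1) {s t : E}
    (hst : s ≠ t) :
    ∫ x, min (φ₀ (x - s)) (φ₀ (x - t)) = 2 * (1 - halfSpaceMass φ₀ e (‖s - t‖ / 2)) := by
  have hδ : t - s ≠ 0 := sub_ne_zero.2 hst.symm
  set δ := t - s with hδdef
  have hint : Integrable fun x => φ₀ (x - δ) := h.integrable.comp_sub_right δ
  have h0 : ∫ x, min (φ₀ (x - s)) (φ₀ (x - t)) = ∫ x, min (φ₀ x) (φ₀ (x - δ)) := by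
    rw [← integral_sub_right_eq_self (fun x => min (φ₀ x) (φ₀ (x - δ))) s]
    refine integral_congr_ae (ae_of_all _ fun x => ?_)
    simp only [hδdef]
    congr 2
    abel
  have hnorm : ∀ x : E, ‖x - δ‖ ^ 2 = ‖x‖ ^ 2 - 2 * ⟪x, δ⟫ + ‖δ‖ ^ 2 := fun x =>
    norm_sub_sq_real x δ
  have hm := measurableSet_lt_inner δ (‖δ‖ ^ 2 / 2)
  have h1 : ∫ x in {x | ‖δ‖ ^ 2 / 2 < ⟪x, δ⟫}, min (φ₀ x) (φ₀ (x - δ)) =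
      1 - halfSpaceMass φ₀ e (‖δ‖ / 2) := by
    rw [← h.setIntegral_lt_inner he hδ]
    refine setIntegral_congr_fun hm fun x hx => ?_
    have hx' : ‖δ‖ ^ 2 / 2 < ⟪x, δ⟫ := hx
    refine min_eq_left (h.le_of_norm_le ?_)
    refine le_of_sq_le_sq (by rw [hnorm]; linarith) (norm_nonneg _)
  have h2 : ∫ x in {x | ‖δ‖ ^ 2 / 2 < ⟪x, δ⟫}ᶜ, min (φ₀ x) (φ₀ (x - δ)) =
      1 - halfSpaceMass φ₀ e (‖δ‖ / 2) := by
    rw [← h.setIntegral_lt_inner he hδ]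
    have h3 : ∫ x in {x | ‖δ‖ ^ 2 / 2 < ⟪x, δ⟫}ᶜ, min (φ₀ x) (φ₀ (x - δ)) =
        ∫ x in {x | ‖δ‖ ^ 2 / 2 < ⟪x, δ⟫}ᶜ, φ₀ (δ - x) := by
      refine setIntegral_congr_fun hm.compl fun x hx => ?_
      have hx' : ⟪x, δ⟫ ≤ ‖δ‖ ^ 2 / 2 := not_lt.1 hx
      change min (φ₀ x) (φ₀ (x - δ)) = φ₀ (δ - x)
      rw [h.eq_of_norm_eq (δ - x) (x - δ) (norm_sub_rev _ _)]
      refine min_eq_right (h.le_of_norm_le ?_)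
      refine le_of_sq_le_sq (by rw [hnorm]; linarith) (norm_nonneg _)
    -- The reflection `x ↦ δ - x` swaps the two sides of the bisector.
    have h4 : {x : E | ‖δ‖ ^ 2 / 2 < ⟪x, δ⟫}ᶜ =
        (fun x => δ - x) ⁻¹' {x | ‖δ‖ ^ 2 / 2 ≤ ⟪x, δ⟫} := by
      ext x
      simp only [mem_compl_iff, mem_ofPred_eq, mem_preimage, inner_sub_left,
        real_inner_self_eq_norm_sq, not_lt]
      constructor <;> intro <;> linarith
    rw [h3, h4, (Measure.measurePreserving_sub_left volume δ).setIntegral_preimage_emb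
      (Homeomorph.subLeft δ).measurableEmbedding φ₀]
    refine setIntegral_congr_set ?_
    have hnull : ∀ᵐ x : E, ⟪x, δ⟫ ≠ ‖δ‖ ^ 2 / 2 := by
      rw [ae_iff]; simpa using volume_inner_eq hδ (‖δ‖ ^ 2 / 2)
    filter_upwards [hnull] with x hx
    exact propext ⟨fun h => lt_of_le_of_ne h hx.symm, fun h => le_of_lt h⟩
  have hmin : Integrable fun x => min (φ₀ x) (φ₀ (x - δ)) := h.integrable.inf hint
  rw [h0, ← integral_add_compl hm hmin, h1, h2, norm_sub_rev s t]
  ring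

/-! ### Linear changes of variables -/

theorem integral_comp_linearMap {A : E →ₗ[ℝ] E} (hA : LinearMap.det A ≠ 0) (g : E → ℝ) :
    ∫ x, |LinearMap.det A| * g (A x) = ∫ x, g x := by
  have hemb : MeasurableEmbedding A :=
    (A.equivOfDetNeZero hA).toContinuousLinearEquiv.toHomeomorph.measurableEmbedding
  rw [integral_const_mul, ← hemb.integral_map, Measure.map_linearMap_addHaar_eq_smul_addHaar _ hA,
    integral_smul_measure, ENNReal.toReal_ofReal (abs_nonneg _), smul_eq_mul, ← mul_assoc,
    ← abs_mul, mul_inv_cancel₀ hA, abs_one, one_mul]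

theorem tailDep_comp_linearMap {ι : Type*} [Fintype ι] [Nonempty ι] {A : E →ₗ[ℝ] E}
    (hA : LinearMap.det A ≠ 0) (φ₀ : E → ℝ) (s : ι → E) :
    tailDep (fun x => |LinearMap.det A| * φ₀ (A x)) s = tailDep φ₀ (fun j => A (s j)) := by
  unfold tailDep
  rw [← integral_comp_linearMap hA fun x =>
    Finset.univ.inf' Finset.univ_nonempty fun j => φ₀ (x - A (s j))]
  refine integral_congr_ae (ae_of_all _ fun x => ?_)
  simp only [map_sub]
  rw [Finset.apply_inf'_eq_inf'_comp Finset.univ_nonempty (fun y => |LinearMap.det A| * y)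
    fun a b => mul_min_of_nonneg a b (abs_nonneg _)]
  rfl

/-- Pairwise tail dependence when the density is a linear image of a radial one. -/
theorem IsRadialDensity.tailDep_comp_linearMap_pair (h : IsRadialDensity φ₀) {e : E}
    (he : ‖e‖ = 1) {A : E →ₗ[ℝ] E} (hA : LinearMap.det A ≠ 0) {s t : E} (hst : s ≠ t) :
    tailDep (fun x => |LinearMap.det A| * φ₀ (A x)) ![s, t] =
      2 * (1 - halfSpaceMass φ₀ e (‖A (s - t)‖ / 2)) := by
  have h1 : (fun j => A (![s, t] j)) = ![A s, A t] := by
    ext j; fin_cases j <;> rfl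
  have h2 : A s ≠ A t := (A.equivOfDetNeZero hA).injective.ne hst
  rw [tailDep_comp_linearMap hA, h1, tailDep_pair, h.integral_min he h2, map_sub]

/-- On the line the minimum over several sites is the minimum over the two extreme sites. -/
theorem tailDep_line {φ₀ : ℝ → ℝ} (h : IsRadialDensity φ₀) {ι : Type*} [Fintype ι] [Nonempty ι]
    (s : ι → ℝ) : tailDep φ₀ s = tailDep φ₀ ![⨆ j, s j, ⨅ j, s j] := by
  obtain ⟨i, hi⟩ := exists_eq_ciSup_of_finite (f := s)
  obtain ⟨i', hi'⟩ := exists_eq_ciInf_of_finite (f := s)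
  have hle : ∀ j, s j ≤ ⨆ j, s j := fun j => le_ciSup (finite_range s).bddAbove j
  have hge : ∀ j, ⨅ j, s j ≤ s j := fun j => ciInf_le (finite_range s).bddBelow j
  rw [tailDep_pair]
  unfold tailDep
  refine integral_congr_ae (ae_of_all _ fun x => ?_)
  apply le_antisymm
  · refine le_min ?_ ?_
    · rw [← hi]; exact Finset.inf'_le _ (Finset.mem_univ i)
    · rw [← hi']; exact Finset.inf'_le _ (Finset.mem_univ i')
  · refine Finset.le_inf' _ _ fun j _ => ?_
    rcases le_total x (s j) with hx | hx
    · refine (min_le_left _ _).trans (h.le_of_norm_le ?_)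
      rw [Real.norm_eq_abs, Real.norm_eq_abs, abs_of_nonpos (by linarith),
        abs_of_nonpos (by linarith [hle j])]
      linarith [hle j]
    · refine (min_le_right _ _).trans (h.le_of_norm_le ?_)
      rw [Real.norm_eq_abs, Real.norm_eq_abs, abs_of_nonneg (by linarith),
        abs_of_nonneg (by linarith [hge j])]
      linarith [hge j]

end

/-! ### The standardized densities are radial -/

theorem lintegral_ofReal_of_integral_eq {α : Type*} [MeasurableSpace α] {μ : Measure α} {f : α → ℝ}
    {c : ℝ} (hf : 0 ≤ᵐ[μ] f) (hc : 0 < c) (h : ∫ x, f x ∂μ = c) :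
    ∫⁻ x, ENNReal.ofReal (f x) ∂μ = ENNReal.ofReal c := by
  have hfi : Integrable f μ := by
    by_contra hcon; rw [integral_undef hcon] at h; exact hc.ne h
  rw [← h, ofReal_integral_eq_lintegral_ofReal hfi hf]

/-- The integral of the multivariate Student density, by writing it as a mixture of Gaussians with
`Γ(a) r ^ (-a) = ∫ s ^ (a - 1) exp (-r s) ds`. -/
theorem integral_one_add_norm_sq_rpow {V : Type*} [NormedAddCommGroup V] [InnerProductSpace ℝ V]
    [FiniteDimensional ℝ V] [MeasurableSpace V] [BorelSpace V] {c a : ℝ} (hc : 0 < c)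
    (ha : (Module.finrank ℝ V : ℝ) / 2 < a) :
    ∫ v : V, (1 + c * ‖v‖ ^ 2) ^ (-a) =
      (Real.pi / c) ^ ((Module.finrank ℝ V : ℝ) / 2) *
        Real.Gamma (a - (Module.finrank ℝ V : ℝ) / 2) / Real.Gamma a := by
  set m : ℝ := (Module.finrank ℝ V : ℝ) / 2 with hm
  have hm0 : 0 ≤ m := by positivity
  have ha0 : 0 < a := hm0.trans_lt ha
  have hΓ : 0 < Real.Gamma a := Real.Gamma_pos_of_pos ha0
  have hpos : ∀ v : V, 0 < 1 + c * ‖v‖ ^ 2 := fun v => by positivity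
  have hK : 0 < (Real.pi / c) ^ m * Real.Gamma (a - m) :=
    mul_pos (Real.rpow_pos_of_pos (by positivity) _) (Real.Gamma_pos_of_pos (by linarith))
  have h1 : ∀ v : V, ENNReal.ofReal (Real.Gamma a * (1 + c * ‖v‖ ^ 2) ^ (-a)) =
      ∫⁻ s in Ioi (0 : ℝ), ENNReal.ofReal (s ^ (a - 1) * Real.exp (-((1 + c * ‖v‖ ^ 2) * s))) := by
    intro v
    have h := Real.integral_rpow_mul_exp_neg_mul_Ioi ha0 (hpos v)
    have hval : (1 / (1 + c * ‖v‖ ^ 2)) ^ a * Real.Gamma a =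
        Real.Gamma a * (1 + c * ‖v‖ ^ 2) ^ (-a) := by
      rw [one_div, Real.inv_rpow (hpos v).le, Real.rpow_neg (hpos v).le, mul_comm]
    rw [hval] at h
    refine (lintegral_ofReal_of_integral_eq ?_
      (mul_pos hΓ (Real.rpow_pos_of_pos (hpos v) _)) h).symm
    filter_upwards [ae_restrict_mem measurableSet_Ioi] with s hs
    exact mul_nonneg (Real.rpow_nonneg (le_of_lt hs) _) (Real.exp_pos _).le
  have h2 : ∀ s ∈ Ioi (0 : ℝ),
      ∫⁻ v : V, ENNReal.ofReal (s ^ (a - 1) * Real.exp (-((1 + c * ‖v‖ ^ 2) * s))) =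
        ENNReal.ofReal ((Real.pi / c) ^ m * (s ^ (a - m - 1) * Real.exp (-(1 * s)))) := by
    intro s hs
    have hs : 0 < s := hs
    have hg := GaussianFourier.integral_rexp_neg_mul_sq_norm (V := V) (mul_pos hc hs)
    refine lintegral_ofReal_of_integral_eq (ae_of_all _ fun v =>
      mul_nonneg (Real.rpow_nonneg hs.le _) (Real.exp_pos _).le)
      (mul_pos (Real.rpow_pos_of_pos (by positivity) _)
        (mul_pos (Real.rpow_pos_of_pos hs _) (Real.exp_pos _))) ?_
    have hfun : ∀ v : V, s ^ (a - 1) * Real.exp (-((1 + c * ‖v‖ ^ 2) * s)) =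
        s ^ (a - 1) * Real.exp (-s) * Real.exp (-(c * s) * ‖v‖ ^ 2) := by
      intro v
      rw [mul_assoc, ← Real.exp_add]
      congr 2
      ring
    simp only [hfun]
    rw [integral_const_mul, hg, ← hm, ← div_div, Real.div_rpow (by positivity) hs.le,
      show a - m - 1 = a - 1 - m by ring, Real.rpow_sub hs (a - 1) m, one_mul]
    ring
  have h3 : ∫⁻ v : V, ENNReal.ofReal (Real.Gamma a * (1 + c * ‖v‖ ^ 2) ^ (-a)) =
      ENNReal.ofReal ((Real.pi / c) ^ m * Real.Gamma (a - m)) := by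
    simp only [h1]
    rw [lintegral_lintegral_swap, setLIntegral_congr_fun measurableSet_Ioi h2]
    · refine lintegral_ofReal_of_integral_eq ?_ hK ?_
      · filter_upwards [ae_restrict_mem measurableSet_Ioi] with s hs
        exact mul_nonneg (Real.rpow_nonneg (by positivity) _)
          (mul_nonneg (Real.rpow_nonneg (le_of_lt hs) _) (Real.exp_pos _).le)
      · rw [integral_const_mul, Real.integral_rpow_mul_exp_neg_mul_Ioi (by linarith) one_pos]
        simp
    · refine Measurable.aemeasurable (Measurable.ennreal_ofReal ?_)
      change Measurable fun p : V × ℝ =>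
        p.2 ^ (a - 1) * Real.exp (-((1 + c * ‖p.1‖ ^ 2) * p.2))
      fun_prop
  have h4 : ∫ v : V, Real.Gamma a * (1 + c * ‖v‖ ^ 2) ^ (-a) =
      (Real.pi / c) ^ m * Real.Gamma (a - m) := by
    rw [integral_eq_lintegral_of_nonneg_ae
      (ae_of_all _ fun v => mul_nonneg hΓ.le (Real.rpow_nonneg (hpos v).le _))
      (Measurable.aestronglyMeasurable (by fun_prop)), h3, ENNReal.toReal_ofReal hK.le]
  rw [integral_const_mul] at h4
  rw [eq_div_iff hΓ.ne', mul_comm, h4]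

theorem isRadialDensity_of_norm {E : Type*} [NormedAddCommGroup E] [InnerProductSpace ℝ E]
    [FiniteDimensional ℝ E] [MeasurableSpace E] [BorelSpace E] {φ₀ : E → ℝ} {h : ℝ → ℝ}
    (hφ : ∀ x, φ₀ x = h ‖x‖) (hm : Measurable h) (hpos : ∀ r, 0 ≤ r → 0 < h r)
    (hanti : StrictAntiOn h (Ici 0)) (hint : ∫ x, φ₀ x = 1) : IsRadialDensity φ₀ where
  measurable := by
    rw [show φ₀ = fun x => h ‖x‖ from funext hφ]
    exact hm.comp measurable_norm
  pos x := by rw [hφ]; exact hpos _ (norm_nonneg _)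
  integral_eq_one := hint
  lt_of_norm_lt x y hxy := by
    rw [hφ, hφ]; exact hanti (norm_nonneg _) (norm_nonneg _) hxy
  eq_of_norm_eq x y hxy := by rw [hφ, hφ, hxy]

theorem strictAntiOn_gaussian {c : ℝ} (hc : 0 < c) :
    StrictAntiOn (fun r : ℝ => c * Real.exp (-r ^ 2 / 2)) (Ici 0) := by
  intro x hx y hy hxy
  refine mul_lt_mul_of_pos_left (Real.exp_lt_exp.2 ?_) hc
  have := pow_lt_pow_left₀ hxy hx two_ne_zero
  linarith

theorem strictAntiOn_student {c b a : ℝ} (hc : 0 < c) (hb : 0 < b) (ha : 0 < a) :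
    StrictAntiOn (fun r : ℝ => c * (1 + b * r ^ 2) ^ (-a)) (Ici 0) := by
  intro x hx y hy hxy
  refine mul_lt_mul_of_pos_left ?_ hc
  have := pow_lt_pow_left₀ hxy hx two_ne_zero
  exact Real.rpow_lt_rpow_of_neg (by positivity) (by nlinarith) (by linarith)

theorem isRadialDensity_normalDensity : IsRadialDensity normalDensity := by
  refine isRadialDensity_of_norm
    (h := fun r => 1 / Real.sqrt (2 * Real.pi) * Real.exp (-r ^ 2 / 2)) (fun x => ?_)
    (by fun_prop) (fun r _ => by positivity) (strictAntiOn_gaussian (by positivity)) ?_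
  · simp [normalDensity, Real.norm_eq_abs, sq_abs]
  · rw [← integral_gaussianPDFReal_eq_one 0 one_ne_zero]
    refine integral_congr_ae (ae_of_all _ fun x => ?_)
    simp [normalDensity, gaussianPDFReal]

theorem isRadialDensity_expDensity : IsRadialDensity expDensity := by
  refine isRadialDensity_of_norm (h := fun r => 1 / 2 * Real.exp (-r)) (fun x => rfl)
    (by fun_prop) (fun r _ => by positivity) ?_ ?_
  · intro x _ y _ hxy
    exact mul_lt_mul_of_pos_left (Real.exp_lt_exp.2 (by linarith)) (by norm_num)
  · unfold expDensity
    rw [integral_const_mul, integral_comp_abs (f := fun x => Real.exp (-x)),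
      integral_exp_neg_Ioi_zero]
    norm_num

theorem isRadialDensity_studentDensity {ν : ℕ} (hν : 0 < ν) :
    IsRadialDensity (studentDensity ν) := by
  have hν' : (0 : ℝ) < ν := by exact_mod_cast hν
  have hΓ1 : 0 < Real.Gamma (((ν : ℝ) + 1) / 2) := Real.Gamma_pos_of_pos (by linarith)
  have hΓ2 : 0 < Real.Gamma ((ν : ℝ) / 2) := Real.Gamma_pos_of_pos (by linarith)
  have hφ : ∀ x, studentDensity ν x =
      Real.Gamma (((ν : ℝ) + 1) / 2) / (Real.sqrt (Real.pi * ν) * Real.Gamma ((ν : ℝ) / 2)) *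
        (1 + (ν : ℝ)⁻¹ * ‖x‖ ^ 2) ^ (-(((ν : ℝ) + 1) / 2)) := by
    intro x
    rw [studentDensity, Real.norm_eq_abs, sq_abs, div_eq_inv_mul (x ^ 2)]
  refine isRadialDensity_of_norm (h := fun r => Real.Gamma (((ν : ℝ) + 1) / 2) /
      (Real.sqrt (Real.pi * ν) * Real.Gamma ((ν : ℝ) / 2)) *
        (1 + (ν : ℝ)⁻¹ * r ^ 2) ^ (-(((ν : ℝ) + 1) / 2))) hφ
    (by fun_prop) (fun r _ => by positivity) (strictAntiOn_student (by positivity) (by positivity)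
      (by positivity)) ?_
  simp only [hφ]
  rw [integral_const_mul, integral_one_add_norm_sq_rpow (by positivity)
    (by rw [Module.finrank_self]; push_cast; linarith), Module.finrank_self, Nat.cast_one,
    show ((ν : ℝ) + 1) / 2 - 1 / 2 = (ν : ℝ) / 2 by ring, div_inv_eq_mul, Real.sqrt_eq_rpow]
  have : 0 < (Real.pi * (ν : ℝ)) ^ ((1 : ℝ) / 2) := Real.rpow_pos_of_pos (by positivity) _
  field_simp

theorem Plane.norm_sq (x : Plane) : ‖x‖ ^ 2 = x 0 ^ 2 + x 1 ^ 2 := by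
  simp [EuclideanSpace.norm_sq_eq, Fin.sum_univ_two]

theorem isRadialDensity_normalDensity₂ : IsRadialDensity normalDensity₂ := by
  have hφ : ∀ x, normalDensity₂ x = 1 / (2 * Real.pi) * Real.exp (-‖x‖ ^ 2 / 2) := by
    intro x
    rw [normalDensity₂, Plane.norm_sq]
  refine isRadialDensity_of_norm (h := fun r => 1 / (2 * Real.pi) * Real.exp (-r ^ 2 / 2)) hφ
    (by fun_prop) (fun r _ => by positivity) (strictAntiOn_gaussian (by positivity)) ?_
  have hg := GaussianFourier.integral_rexp_neg_mul_sq_norm (V := Plane) (b := 1 / 2) (by norm_num)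
  have hfun : ∀ x : Plane, normalDensity₂ x =
      1 / (2 * Real.pi) * Real.exp (-(1 / 2) * ‖x‖ ^ 2) := by
    intro x
    rw [hφ]
    congr 2
    ring
  simp only [hfun]
  rw [integral_const_mul, hg, finrank_euclideanSpace_fin]
  have := Real.pi_pos
  norm_num
  field_simp

theorem isRadialDensity_studentDensity₂ {α : ℝ} (hα : 1 < α) :
    IsRadialDensity (studentDensity₂ α) := by
  have hα' : 0 < 2 * (α - 1) := by linarith
  have hφ : ∀ x, studentDensity₂ α x =
      1 / (2 * Real.pi) * (1 + (2 * (α - 1))⁻¹ * ‖x‖ ^ 2) ^ (-α) := by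
    intro x
    rw [studentDensity₂, Plane.norm_sq, div_eq_inv_mul (x 0 ^ 2 + x 1 ^ 2)]
  refine isRadialDensity_of_norm
    (h := fun r => 1 / (2 * Real.pi) * (1 + (2 * (α - 1))⁻¹ * r ^ 2) ^ (-α)) hφ
    (by fun_prop) (fun r _ => by positivity) (strictAntiOn_student (by positivity) (by positivity)
      (by positivity)) ?_
  have hfr : (Module.finrank ℝ Plane : ℝ) / 2 = 1 := by
    rw [finrank_euclideanSpace_fin]; norm_num
  simp only [hφ]
  rw [integral_const_mul, integral_one_add_norm_sq_rpow (by positivity) (by rw [hfr]; exact hα),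
    hfr, Real.rpow_one]
  have hΓ : Real.Gamma α = (α - 1) * Real.Gamma (α - 1) := by
    have := Real.Gamma_add_one (s := α - 1) (by linarith)
    rwa [sub_add_cancel] at this
  have h1 : 0 < Real.Gamma (α - 1) := Real.Gamma_pos_of_pos (by linarith)
  have h2 : α - 1 ≠ 0 := by linarith
  have := Real.pi_pos
  rw [hΓ]
  field_simp

/-! ### Integrals over the plane -/

theorem Plane.measurePreserving_coords :
    MeasurePreserving (fun x : Plane => (x 0, x 1)) volume volume :=
  (volume_preserving_finTwoArrow ℝ).comp (PiLp.volume_preserving_ofLp (Fin 2))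

theorem Plane.measurableEmbedding_coords : MeasurableEmbedding fun x : Plane => (x 0, x 1) :=
  (MeasurableEquiv.finTwoArrow (α := ℝ)).measurableEmbedding.comp
    (MeasurableEquiv.toLp 2 (Fin 2 → ℝ)).symm.measurableEmbedding

theorem Plane.integral_eq (f : ℝ × ℝ → ℝ) : ∫ x : Plane, f (x 0, x 1) = ∫ p, f p :=
  Plane.measurePreserving_coords.integral_comp Plane.measurableEmbedding_coords f

theorem marginalDistFun_normalDensity₂ :
    marginalDistFun normalDensity₂ = distFun normalDensity := by
  ext u
  have hint : ∫ y, normalDensity y = 1 := isRadialDensity_normalDensity.integral_eq_one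
  have h1 := Plane.measurePreserving_coords.setIntegral_preimage_emb
    Plane.measurableEmbedding_coords (fun p : ℝ × ℝ => normalDensity p.1 * normalDensity p.2)
    (Iic u ×ˢ univ)
  have h2 : (fun x : Plane => (x 0, x 1)) ⁻¹' (Iic u ×ˢ univ) = {x : Plane | x 0 ≤ u} := by
    ext x; simp
  rw [h2, Measure.volume_eq_prod, setIntegral_prod_mul, setIntegral_univ, hint, mul_one] at h1
  unfold marginalDistFun distFun
  rw [← h1]
  congr 1
  ext x
  have hs : Real.sqrt (2 * Real.pi) * Real.sqrt (2 * Real.pi) = 2 * Real.pi :=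
    Real.mul_self_sqrt (by positivity)
  unfold normalDensity₂ normalDensity
  rw [mul_mul_mul_comm, ← Real.exp_add, div_mul_div_comm, hs, one_mul]
  congr 2
  ring

/-! ### Tail dependence in the exponential model -/

/-- The inner integral in the exponential model; `c` is the logarithm of the ratio of the factors
that belong to the other coordinate. -/
theorem integral_min_exp_abs {b c : ℝ} (hc : |c| ≤ |b|) :
    ∫ y : ℝ, min (1 / 2 * Real.exp (-|y|)) (Real.exp c * (1 / 2 * Real.exp (-|y - b|))) =
      Real.exp ((c - |b|) / 2) := by
  wlog hb : 0 ≤ b generalizing b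
  · have := this (b := -b) (by rwa [abs_neg]) (by linarith)
    rw [abs_neg] at this
    rw [← this, ← integral_neg_eq_self]
    refine integral_congr_ae (ae_of_all _ fun y => ?_)
    simp only [abs_neg]
    rw [show -y - b = -(y - -b) by ring, abs_neg]
  rw [abs_of_nonneg hb] at hc ⊢
  obtain ⟨hc1, hc2⟩ := abs_le.1 hc
  have hint : Integrable fun y : ℝ =>
      min (1 / 2 * Real.exp (-|y|)) (Real.exp c * (1 / 2 * Real.exp (-|y - b|))) :=
    isRadialDensity_expDensity.integrable.inf
      ((isRadialDensity_expDensity.integrable.comp_sub_right b).const_mul _)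
  -- The two densities cross at `(b - c) / 2`, which lies between `0` and `b`.
  rw [← integral_add_compl (measurableSet_Iic (a := (b - c) / 2)) hint, compl_Iic]
  have h1 : ∫ y in Iic ((b - c) / 2),
      min (1 / 2 * Real.exp (-|y|)) (Real.exp c * (1 / 2 * Real.exp (-|y - b|))) =
      1 / 2 * Real.exp ((c - b) / 2) := by
    have : ∀ y ∈ Iic ((b - c) / 2),
        min (1 / 2 * Real.exp (-|y|)) (Real.exp c * (1 / 2 * Real.exp (-|y - b|))) =
        1 / 2 * Real.exp (c - b) * Real.exp y := by
      intro y hy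
      rw [mem_Iic] at hy
      have e : Real.exp c * (1 / 2 * Real.exp (-|y - b|)) =
          1 / 2 * Real.exp (c - b) * Real.exp y := by
        rw [abs_of_nonpos (by linarith), mul_left_comm, ← Real.exp_add, mul_assoc, ← Real.exp_add]
        congr 2; ring
      rw [e, min_eq_right]
      rw [mul_assoc, ← Real.exp_add]
      refine mul_le_mul_of_nonneg_left (Real.exp_le_exp.2 ?_) (by norm_num)
      rcases abs_cases y with h | h <;> linarith
    rw [setIntegral_congr_fun measurableSet_Iic this, integral_const_mul, integral_exp_Iic,
      mul_assoc, ← Real.exp_add]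
    congr 2; ring
  have h2 : ∫ y in Ioi ((b - c) / 2),
      min (1 / 2 * Real.exp (-|y|)) (Real.exp c * (1 / 2 * Real.exp (-|y - b|))) =
      1 / 2 * Real.exp ((c - b) / 2) := by
    have : ∀ y ∈ Ioi ((b - c) / 2),
        min (1 / 2 * Real.exp (-|y|)) (Real.exp c * (1 / 2 * Real.exp (-|y - b|))) =
        1 / 2 * Real.exp (-y) := by
      intro y hy
      rw [mem_Ioi] at hy
      rw [abs_of_nonneg (by linarith : 0 ≤ y), min_eq_left]
      rw [mul_left_comm, ← Real.exp_add]
      refine mul_le_mul_of_nonneg_left (Real.exp_le_exp.2 ?_) (by norm_num)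
      rcases abs_cases (y - b) with h | h <;> linarith
    rw [setIntegral_congr_fun measurableSet_Ioi this, integral_const_mul, integral_exp_neg_Ioi]
    congr 2; ring
  rw [h1, h2]
  ring

theorem integral_exp_abs_add_abs (a : ℝ) :
    ∫ x : ℝ, Real.exp (-((|x| + |x - a|) / 2)) = (2 + |a|) * Real.exp (-(|a| / 2)) := by
  wlog ha : 0 ≤ a generalizing a
  · have := this (-a) (by linarith)
    rw [abs_neg] at this
    rw [← this, ← integral_neg_eq_self]
    refine integral_congr_ae (ae_of_all _ fun y => ?_)
    simp only [abs_neg]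
    rw [show -y - a = -(y - -a) by ring, abs_neg]
  rw [abs_of_nonneg ha]
  have e1 : ∀ x ∈ Iic (0 : ℝ), Real.exp (-((|x| + |x - a|) / 2)) =
      Real.exp (-(a / 2)) * Real.exp x := by
    intro x hx
    rw [mem_Iic] at hx
    rw [abs_of_nonpos hx, abs_of_nonpos (by linarith), ← Real.exp_add]
    congr 1; ring
  have e2 : ∀ x ∈ Ioc (0 : ℝ) a, Real.exp (-((|x| + |x - a|) / 2)) = Real.exp (-(a / 2)) := by
    intro x hx
    rw [abs_of_pos hx.1, abs_of_nonpos (by linarith [hx.2])]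
    congr 1; ring
  have e3 : ∀ x ∈ Ioi a, Real.exp (-((|x| + |x - a|) / 2)) =
      Real.exp (a / 2) * Real.exp (-x) := by
    intro x hx
    rw [mem_Ioi] at hx
    rw [abs_of_nonneg (by linarith), abs_of_nonneg (by linarith), ← Real.exp_add]
    congr 1; ring
  have i1 : IntegrableOn (fun x => Real.exp (-((|x| + |x - a|) / 2))) (Iic 0) :=
    IntegrableOn.congr_fun ((integrableOn_exp_Iic 0).const_mul _)
      (fun x hx => (e1 x hx).symm) measurableSet_Iic
  have i2 : IntegrableOn (fun x => Real.exp (-((|x| + |x - a|) / 2))) (Ioc 0 a) :=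
    (Continuous.integrableOn_Ioc (by fun_prop))
  have i3 : IntegrableOn (fun x => Real.exp (-((|x| + |x - a|) / 2))) (Ioi a) := by
    have h : IntegrableOn (fun x => Real.exp (-x)) (Ioi a) := by
      simpa using exp_neg_integrableOn_Ioi a one_pos
    exact IntegrableOn.congr_fun (f := fun x => Real.exp (a / 2) * Real.exp (-x))
      (Integrable.const_mul h _) (fun x hx => (e3 x hx).symm) measurableSet_Ioi
  have i23 : IntegrableOn (fun x => Real.exp (-((|x| + |x - a|) / 2))) (Ioi 0) := by
    rw [← Ioc_union_Ioi_eq_Ioi ha]; exact i2.union i3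
  have itot : Integrable fun x => Real.exp (-((|x| + |x - a|) / 2)) := by
    rw [← integrableOn_univ, ← Iic_union_Ioi (a := (0 : ℝ))]; exact i1.union i23
  rw [← integral_add_compl (measurableSet_Iic (a := (0 : ℝ))) itot, compl_Iic,
    ← Ioc_union_Ioi_eq_Ioi ha, setIntegral_union
      (Ioc_disjoint_Ioi le_rfl) measurableSet_Ioi i2 i3,
    setIntegral_congr_fun measurableSet_Iic e1, setIntegral_congr_fun measurableSet_Ioc e2,
    setIntegral_congr_fun measurableSet_Ioi e3, integral_const_mul, integral_const_mul,
    integral_exp_Iic_zero, integral_exp_neg_Ioi, setIntegral_const, Real.volume_real_Ioc_of_le ha,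
    ← Real.exp_add]
  rw [show a / 2 + -a = -(a / 2) by ring, smul_eq_mul]
  ring

/-- Integrate first over the coordinate with the larger difference of the sites. -/
theorem integral_min_exp_prod_of_le {a b : ℝ} (hab : |a| ≤ |b|) :
    ∫ x : ℝ, ∫ y : ℝ, min (expDensity x * expDensity y) (expDensity (x - a) * expDensity (y - b)) =
      (1 + |a| / 2) * Real.exp (-((|a| + |b|) / 2)) := by
  have h1 : ∀ x, ∫ y : ℝ,
      min (expDensity x * expDensity y) (expDensity (x - a) * expDensity (y - b)) =
      1 / 2 * Real.exp (-(|b| / 2)) * Real.exp (-((|x| + |x - a|) / 2)) := by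
    intro x
    have hc : |(|x| - |x - a|)| ≤ |b| := by
      refine (abs_abs_sub_abs_le_abs_sub x (x - a)).trans ?_
      rwa [sub_sub_cancel]
    have h2 : ∀ y,
        min (expDensity x * expDensity y) (expDensity (x - a) * expDensity (y - b)) =
        expDensity x * min (1 / 2 * Real.exp (-|y|))
          (Real.exp (|x| - |x - a|) * (1 / 2 * Real.exp (-|y - b|))) := by
      intro y
      unfold expDensity
      rw [mul_min_of_nonneg _ _ (by positivity)]
      congr 1
      have he : Real.exp (-|x - a|) = Real.exp (-|x|) * Real.exp (|x| - |x - a|) := by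
        rw [← Real.exp_add]; congr 1; ring
      rw [he]; ring
    simp only [h2]
    rw [integral_const_mul, integral_min_exp_abs hc, expDensity, mul_assoc, ← Real.exp_add,
      mul_assoc, ← Real.exp_add]
    congr 2; ring
  simp only [h1]
  have he : Real.exp (-((|a| + |b|) / 2)) = Real.exp (-(|b| / 2)) * Real.exp (-(|a| / 2)) := by
    rw [← Real.exp_add]; congr 1; ring
  rw [integral_const_mul, integral_exp_abs_add_abs, he]
  ring

theorem expDensity₂_eq (x : Plane) : expDensity₂ x = expDensity (x 0) * expDensity (x 1) := by
  unfold expDensity₂ expDensity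
  rw [mul_mul_mul_comm, ← Real.exp_add, ← neg_add]
  norm_num

theorem integral_expDensity₂ : ∫ x, expDensity₂ x = 1 := by
  simp only [expDensity₂_eq]
  rw [Plane.integral_eq fun p => expDensity p.1 * expDensity p.2, Measure.volume_eq_prod,
    integral_prod_mul, isRadialDensity_expDensity.integral_eq_one, mul_one]

theorem tailDep_expDensity₂ (s t : Plane) :
    tailDep expDensity₂ ![s, t] = expDep |s 0 - t 0| |s 1 - t 1| 1 := by
  set a := t 0 - s 0 with ha
  set b := t 1 - s 1 with hb
  rw [abs_sub_comm (s 0), abs_sub_comm (s 1), ← ha, ← hb, tailDep_pair]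
  have h0 : ∫ x, min (expDensity₂ (x - s)) (expDensity₂ (x - t)) =
      ∫ x, min (expDensity₂ x) (expDensity₂ (x - (t - s))) := by
    rw [← integral_sub_right_eq_self (fun x => min (expDensity₂ x) (expDensity₂ (x - (t - s)))) s]
    refine integral_congr_ae (ae_of_all _ fun x => ?_)
    simp only [sub_sub, add_sub_cancel]
  have hφ := isRadialDensity_expDensity.integrable
  have hint : Integrable (fun p : ℝ × ℝ => min (expDensity p.1 * expDensity p.2)
      (expDensity (p.1 - a) * expDensity (p.2 - b))) (volume.prod volume) :=
    (hφ.mul_prod hφ).inf ((hφ.comp_sub_right a).mul_prod (hφ.comp_sub_right b))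
  rw [h0]
  simp only [expDensity₂_eq, PiLp.sub_apply, ← ha, ← hb]
  rw [Plane.integral_eq fun p => min (expDensity p.1 * expDensity p.2)
      (expDensity (p.1 - a) * expDensity (p.2 - b)), Measure.volume_eq_prod]
  unfold expDep
  rcases le_total |a| |b| with h | h
  · rw [integral_prod _ hint, integral_min_exp_prod_of_le h, min_eq_left h]
    congr 2 <;> ring
  · rw [integral_prod_symm _ hint, min_eq_right h]
    have hswap : ∀ x y, min (expDensity x * expDensity y)
        (expDensity (x - a) * expDensity (y - b)) =
        min (expDensity y * expDensity x) (expDensity (y - b) * expDensity (x - a)) := fun x y => by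
      rw [mul_comm (expDensity x), mul_comm (expDensity (x - a))]
    simp only [hswap]
    rw [integral_min_exp_prod_of_le h]
    congr 2 <;> ring

/-! ### Consistency of the estimators -/

theorem card_pairs (d : ℕ) :
    ((Finset.univ.filter fun p : Fin d × Fin d => p.1 < p.2).card : ℝ) * 2 = d * (d - 1) := by
  have h1 : (Finset.univ.filter fun p : Fin d × Fin d => p.1 < p.2).card =
      ∑ i ∈ Finset.range d, i := by
    rw [Finset.card_filter, Fintype.sum_prod_type_right, ← Fin.sum_univ_eq_sum_range (fun i => i) d]
    refine Finset.sum_congr rfl fun m _ => ?_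
    rw [← Finset.card_filter]
    simp [Finset.filter_gt_eq_Iio, Fin.card_Iio]
  have h2 := Finset.sum_range_id_mul_two d
  rw [← h1] at h2
  rcases Nat.eq_zero_or_pos d with rfl | hd
  · simp
  · have := congrArg (Nat.cast (R := ℝ)) h2
    rwa [Nat.cast_mul, Nat.cast_mul, Nat.cast_pred hd, Nat.cast_two] at this

theorem weaklyConsistent_pairAverage {Ω : Type*} [MeasurableSpace Ω] {P : Measure Ω} {d : ℕ}
    (hd : 2 ≤ d) {T : Fin d → Fin d → ℕ → Ω → ℝ} {θ : ℝ}
    (h : ∀ j m, j < m → WeaklyConsistent P (T j m) θ) :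
    WeaklyConsistent P (fun n ω => pairAverage d fun j m => T j m n ω) θ := by
  have hsum : ∀ f : Fin d × Fin d → ℝ,
      ∑ p ∈ Finset.univ.filter (fun p : Fin d × Fin d => p.1 < p.2), f p =
        ∑ p : Pairs d, f p.1 := fun f =>
    Finset.sum_subtype _ (by simp) f
  have hcont : Continuous fun x : Pairs d → ℝ =>
      2 / ((d : ℝ) * ((d : ℝ) - 1)) * ∑ p : Pairs d, x p := by fun_prop
  have := WeaklyConsistent.comp_pi (ι := Pairs d) (T := fun p => T p.1.1 p.1.2)
    (θ := fun _ => θ) (fun p => h _ _ p.2) hcont.continuousAt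
  have hval : 2 / ((d : ℝ) * ((d : ℝ) - 1)) * ∑ _p : Pairs d, θ = θ := by
    rw [← hsum fun _ => θ, Finset.sum_const, nsmul_eq_mul]
    have hd' : (2 : ℝ) ≤ d := by exact_mod_cast hd
    have h1 : (d : ℝ) ≠ 0 := by linarith
    have h2 : (d : ℝ) - 1 ≠ 0 := by linarith
    have h3 := card_pairs d
    field_simp
    linear_combination θ * h3
  rw [hval] at this
  unfold pairAverage
  simpa only [hsum fun p => T p.1 p.2 _ _] using this

/-- In the models with radial densities `R (1, 1) = 2 (1 - F v)` for some `v`, which is recovered by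
inverting `F`. -/
theorem weaklyConsistent_quantile {Ω : Type*} [MeasurableSpace Ω] {P : Measure Ω} {F : ℝ → ℝ}
    (hF : StrictMono F) {T : ℕ → Ω → ℝ} {v : ℝ} (h : WeaklyConsistent P T (2 * (1 - F v))) :
    WeaklyConsistent P (fun n ω => quantile F (1 - T n ω / 2)) v := by
  obtain ⟨h1, h2⟩ := continuousAt_quantile hF.monotone (v := v) (fun u hu => hF hu)
    fun u hu => hF hu
  have h3 : 1 - 2 * (1 - F v) / 2 = F v := by ring
  have hc : ContinuousAt (fun r => quantile F (1 - r / 2)) (2 * (1 - F v)) :=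
    ContinuousAt.comp (g := quantile F) (f := fun r => 1 - r / 2) (by rwa [h3]) (by fun_prop)
  have := h.comp hc
  rwa [h3, h2] at this

section
variable {E : Type*} [NormedAddCommGroup E] [InnerProductSpace ℝ E] [FiniteDimensional ℝ E]
  [MeasurableSpace E] [BorelSpace E]

theorem weaklyConsistent_RHat_comp_linearMap {Ω Ω' ι : Type*} [MeasurableSpace Ω]
    [MeasurableSpace Ω'] [Fintype ι] [Nonempty ι] {P : Measure Ω} [IsProbabilityMeasure P]
    {P' : Measure Ω'} [IsProbabilityMeasure P'] {φ₀ : E → ℝ} (hφ : Measurable φ₀)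
    (hφ0 : ∀ x, 0 ≤ φ₀ x) (hφ1 : ∫ x, φ₀ x = 1) {A : E →ₗ[ℝ] E} (hA : LinearMap.det A ≠ 0)
    {X : ℕ → Ω → C(E, ℝ)} {Zt : Ω' → C(E, ℝ)} (hX : MaximaConverge P X P' Zt)
    (hZ : IsModelLimit P' (fun x => |LinearMap.det A| * φ₀ (A x)) Zt) {k : ℕ → ℕ}
    (hk : Tendsto k atTop atTop) (hkn : Tendsto (fun n : ℕ => (k n : ℝ) / (n : ℝ)) atTop (𝓝 0))
    (s : ι → E) :
    WeaklyConsistent P (fun n ω => RHat n (k n) (fun i => X i ω) s fun _ => 1)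
      (tailDep φ₀ fun j => A (s j)) := by
  rw [← tailDep_comp_linearMap hA]
  refine weaklyConsistent_RHat ?_ (fun x => mul_nonneg (abs_nonneg _) (hφ0 _)) ?_ hX hZ hk hkn s
  · exact (hφ.comp (LinearMap.continuous_of_finiteDimensional A).measurable).const_mul _
  · rw [integral_comp_linearMap hA, hφ1]

theorem IsRadialDensity.weaklyConsistent_quantile_RHatPair {Ω Ω' : Type*} [MeasurableSpace Ω]
    [MeasurableSpace Ω'] {P : Measure Ω} [IsProbabilityMeasure P] {P' : Measure Ω'}
    [IsProbabilityMeasure P'] {φ₀ : E → ℝ} (h : IsRadialDensity φ₀) {e : E} (he : ‖e‖ = 1)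
    {A : E →ₗ[ℝ] E} (hA : LinearMap.det A ≠ 0)
    {X : ℕ → Ω → C(E, ℝ)} {Zt : Ω' → C(E, ℝ)} (hX : MaximaConverge P X P' Zt)
    (hZ : IsModelLimit P' (fun x => |LinearMap.det A| * φ₀ (A x)) Zt) {k : ℕ → ℕ}
    (hk : Tendsto k atTop atTop) (hkn : Tendsto (fun n : ℕ => (k n : ℝ) / (n : ℝ)) atTop (𝓝 0))
    {s t : E} (hst : s ≠ t) :
    WeaklyConsistent P (fun n ω => quantile (halfSpaceMass φ₀ e)
      (1 - RHatPair n (k n) (fun i => X i ω) s t / 2)) (‖A (s - t)‖ / 2) := by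
  refine weaklyConsistent_quantile (h.strictMono_halfSpaceMass he) ?_
  rw [← h.tailDep_comp_linearMap_pair he hA hst, tailDep_comp_linearMap hA]
  simp only [RHatPair_eq]
  exact weaklyConsistent_RHat_comp_linearMap h.measurable (fun x => (h.pos x).le)
    h.integral_eq_one hA hX hZ hk hkn _

omit [MeasurableSpace E] [BorelSpace E] in
theorem det_smul_id {β : ℝ} :
    LinearMap.det (β • LinearMap.id : E →ₗ[ℝ] E) = β ^ Module.finrank ℝ E := by
  rw [LinearMap.det_smul, LinearMap.det_id, mul_one]

theorem IsRadialDensity.weaklyConsistent_betaHatPairs {Ω Ω' : Type*} [MeasurableSpace Ω]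
    [MeasurableSpace Ω'] {P : Measure Ω} [IsProbabilityMeasure P] {P' : Measure Ω'}
    [IsProbabilityMeasure P'] {φ₀ : E → ℝ} (h : IsRadialDensity φ₀) {e : E} (he : ‖e‖ = 1)
    {β : ℝ} (hβ : 0 < β) {X : ℕ → Ω → C(E, ℝ)} {Zt : Ω' → C(E, ℝ)}
    (hX : MaximaConverge P X P' Zt)
    (hZ : IsModelLimit P' (fun x => β ^ Module.finrank ℝ E * φ₀ (β • x)) Zt) {k : ℕ → ℕ}
    (hk : Tendsto k atTop atTop) (hkn : Tendsto (fun n : ℕ => (k n : ℝ) / (n : ℝ)) atTop (𝓝 0))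
    {d : ℕ} (hd : 2 ≤ d) {t : Fin d → E} (ht : Function.Injective t) :
    WeaklyConsistent P
      (fun n ω => betaHatPairs (halfSpaceMass φ₀ e) n (k n) (fun i => X i ω) t) β := by
  have hdet : |LinearMap.det (β • LinearMap.id : E →ₗ[ℝ] E)| = β ^ Module.finrank ℝ E := by
    rw [det_smul_id, abs_of_pos (by positivity)]
  have hA : LinearMap.det (β • LinearMap.id : E →ₗ[ℝ] E) ≠ 0 := by
    rw [det_smul_id]; positivity
  rw [← hdet] at hZ
  refine weaklyConsistent_pairAverage hd fun j m hjm => ?_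
  have hne : t j ≠ t m := ht.ne hjm.ne
  have hn : ‖t j - t m‖ ≠ 0 := norm_ne_zero_iff.2 (sub_ne_zero.2 hne)
  have := (h.weaklyConsistent_quantile_RHatPair he hA hX hZ hk hkn hne).comp
    (f := fun x => 2 / ‖t j - t m‖ * x) (by fun_prop)
  have hval : 2 / ‖t j - t m‖ * (‖(β • LinearMap.id : E →ₗ[ℝ] E) (t j - t m)‖ / 2) = β := by
    rw [LinearMap.smul_apply, LinearMap.id_apply, norm_smul, Real.norm_of_nonneg hβ.le]
    field_simp
  rwa [hval] at this

end

theorem halfSpaceMass_one (φ₀ : ℝ → ℝ) : halfSpaceMass φ₀ 1 = distFun φ₀ := by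
  ext u
  unfold halfSpaceMass distFun
  congr 2
  ext x
  simp

theorem halfSpaceMass_single (φ₀ : Plane → ℝ) :
    halfSpaceMass φ₀ (EuclideanSpace.single 0 1) = marginalDistFun φ₀ := by
  ext u
  unfold halfSpaceMass marginalDistFun
  congr 2
  ext x
  simp [EuclideanSpace.inner_single_right]

theorem isRadialDensity_of_mem_lineDensities {φ₀ : ℝ → ℝ} (h : φ₀ ∈ lineDensities) :
    IsRadialDensity φ₀ := by
  rcases h with (rfl | rfl) | ⟨ν, hν, rfl⟩
  · exact isRadialDensity_normalDensity
  · exact isRadialDensity_expDensity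
  · exact isRadialDensity_studentDensity hν

theorem isRadialDensity_of_mem_sphericalDensities {φ₀ : Plane → ℝ}
    (h : φ₀ ∈ sphericalDensities) : IsRadialDensity φ₀ := by
  rcases h with rfl | ⟨α, hα, rfl⟩
  · exact isRadialDensity_normalDensity₂
  · exact isRadialDensity_studentDensity₂ hα

theorem IsRadialDensity.weaklyConsistent_betaHatRange {Ω Ω' : Type*} [MeasurableSpace Ω]
    [MeasurableSpace Ω'] {P : Measure Ω} [IsProbabilityMeasure P] {P' : Measure Ω'}
    [IsProbabilityMeasure P'] {φ₀ : ℝ → ℝ} (h : IsRadialDensity φ₀)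
    {β : ℝ} (hβ : 0 < β) {X : ℕ → Ω → C(ℝ, ℝ)} {Zt : Ω' → C(ℝ, ℝ)}
    (hX : MaximaConverge P X P' Zt) (hZ : IsModelLimit P' (fun x => β * φ₀ (β * x)) Zt)
    {k : ℕ → ℕ} (hk : Tendsto k atTop atTop)
    (hkn : Tendsto (fun n : ℕ => (k n : ℝ) / (n : ℝ)) atTop (𝓝 0))
    {d : ℕ} (hd : 2 ≤ d) {t : Fin d → ℝ} (ht : Function.Injective t) :
    WeaklyConsistent P (fun n ω => betaHatRange (distFun φ₀) n (k n) (fun i => X i ω) t) β := by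
  have : Nonempty (Fin d) := ⟨⟨0, by omega⟩⟩
  have hdet : LinearMap.det (β • LinearMap.id : ℝ →ₗ[ℝ] ℝ) = β := by
    rw [det_smul_id, Module.finrank_self, pow_one]
  have hA : LinearMap.det (β • LinearMap.id : ℝ →ₗ[ℝ] ℝ) ≠ 0 := by rw [hdet]; exact hβ.ne'
  have hD : 0 < (⨆ j, t j) - ⨅ j, t j := by
    have hle : ∀ j, t j ≤ ⨆ j, t j := fun j => le_ciSup (finite_range t).bddAbove j
    have hge : ∀ j, ⨅ j, t j ≤ t j := fun j => ciInf_le (finite_range t).bddBelow j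
    have hne : t ⟨0, by omega⟩ ≠ t ⟨1, by omega⟩ := ht.ne (by simp)
    rcases lt_or_gt_of_ne hne with h1 | h1
    · linarith [hle ⟨1, by omega⟩, hge ⟨0, by omega⟩]
    · linarith [hle ⟨0, by omega⟩, hge ⟨1, by omega⟩]
  set D := (⨆ j, t j) - ⨅ j, t j with hDdef
  have hR := weaklyConsistent_RHat_comp_linearMap h.measurable (fun x => (h.pos x).le)
    h.integral_eq_one hA hX (by rw [hdet, abs_of_pos hβ]; exact hZ) hk hkn t
  have hdep : tailDep φ₀ (fun j => (β • LinearMap.id : ℝ →ₗ[ℝ] ℝ) (t j)) =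
      2 * (1 - halfSpaceMass φ₀ 1 (β * D / 2)) := by
    have h1 : (fun j => (β • LinearMap.id : ℝ →ₗ[ℝ] ℝ) (t j)) = fun j => β * t j := rfl
    have h2 : (⨆ j, β * t j) - ⨅ j, β * t j = β * D := by
      rw [hDdef, ← Real.mul_iSup_of_nonneg hβ.le, ← Real.mul_iInf_of_nonneg hβ.le, mul_sub]
    have h3 : 0 < β * D := mul_pos hβ hD
    rw [h1, tailDep_line h, tailDep_pair, h.integral_min norm_one (by intro h4; linarith), h2,
      Real.norm_of_nonneg h3.le]
  rw [hdep] at hR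
  have := (weaklyConsistent_quantile (h.strictMono_halfSpaceMass norm_one) hR).comp
    (f := fun x => 2 * x / D) (by fun_prop)
  have hval : 2 * (β * D / 2) / D = β := by field_simp
  rw [hval, halfSpaceMass_one] at this
  exact this

theorem weaklyConsistent_betaHatExp {Ω Ω' : Type*} [MeasurableSpace Ω]
    [MeasurableSpace Ω'] {P : Measure Ω} [IsProbabilityMeasure P] {P' : Measure Ω'}
    [IsProbabilityMeasure P'] {β : ℝ} (hβ : 0 < β) {X : ℕ → Ω → C(Plane, ℝ)}
    {Zt : Ω' → C(Plane, ℝ)} (hX : MaximaConverge P X P' Zt)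
    (hZ : IsModelLimit P' (fun x => β ^ 2 * expDensity₂ (β • x)) Zt)
    {k : ℕ → ℕ} (hk : Tendsto k atTop atTop)
    (hkn : Tendsto (fun n : ℕ => (k n : ℝ) / (n : ℝ)) atTop (𝓝 0))
    {d : ℕ} (hd : 2 ≤ d) {t : Fin d → Plane} (ht : Function.Injective t) :
    WeaklyConsistent P (fun n ω => betaHatExp n (k n) (fun i => X i ω) t) β := by
  have hdet : LinearMap.det (β • LinearMap.id : Plane →ₗ[ℝ] Plane) = β ^ 2 := by
    rw [det_smul_id, finrank_euclideanSpace_fin]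
  have hA : LinearMap.det (β • LinearMap.id : Plane →ₗ[ℝ] Plane) ≠ 0 := by
    rw [hdet]; positivity
  refine weaklyConsistent_pairAverage hd fun j m hjm => ?_
  set a := |t j 0 - t m 0| with ha
  set b := |t j 1 - t m 1| with hb
  have hab : 0 < a + b := by
    refine lt_of_le_of_ne (by positivity) fun h0 => ht.ne hjm.ne ?_
    have h1 : a = 0 := by linarith [abs_nonneg (t j 0 - t m 0), abs_nonneg (t j 1 - t m 1)]
    have h2 : b = 0 := by linarith [abs_nonneg (t j 0 - t m 0), abs_nonneg (t j 1 - t m 1)]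
    ext i
    fin_cases i
    · exact sub_eq_zero.1 (abs_eq_zero.1 h1)
    · exact sub_eq_zero.1 (abs_eq_zero.1 h2)
  have hR := weaklyConsistent_RHat_comp_linearMap (φ₀ := expDensity₂)
    (by unfold expDensity₂; fun_prop) (fun x => by unfold expDensity₂; positivity)
    integral_expDensity₂ hA hX (by rw [hdet, abs_of_pos (by positivity)]; exact hZ) hk hkn
    ![t j, t m]
  have hdep : tailDep expDensity₂
      (fun i => (β • LinearMap.id : Plane →ₗ[ℝ] Plane) (![t j, t m] i)) = expDep a b β := by
    have h1 : (fun i => (β • LinearMap.id : Plane →ₗ[ℝ] Plane) (![t j, t m] i)) =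
        ![β • t j, β • t m] := by
      ext i; fin_cases i <;> rfl
    rw [h1, tailDep_expDensity₂]
    simp only [PiLp.smul_apply, smul_eq_mul, ← mul_sub, abs_mul, abs_of_pos hβ, ← ha, ← hb]
    unfold expDep
    rw [← mul_min_of_nonneg _ _ hβ.le]
    congr 2 <;> ring
  rw [hdep] at hR
  obtain ⟨hc, hv⟩ := continuousAt_Q (abs_nonneg _) (abs_nonneg _) hab hβ
  have := hR.comp hc
  rw [hv] at this
  simpa only [RHatPair_eq] using this

/-! ### The general normal model -/

/-- A triangular square root of the quadratic form of the general normal density; it carries that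
density to the standard one. -/
noncomputable def normalFactor (β₁ β₂ ρ : ℝ) : Plane →ₗ[ℝ] Plane :=
  Matrix.toEuclideanLin !![β₁ / Real.sqrt (1 - ρ ^ 2), -(ρ * β₂) / Real.sqrt (1 - ρ ^ 2); 0, β₂]

theorem det_normalFactor (β₁ β₂ ρ : ℝ) :
    LinearMap.det (normalFactor β₁ β₂ ρ) = β₁ * β₂ / Real.sqrt (1 - ρ ^ 2) := by
  rw [normalFactor, LinearMap.det_toLpLin, Matrix.det_fin_two_of]
  ring

theorem norm_sq_normalFactor {β₁ β₂ ρ : ℝ} (h : 0 < 1 - ρ ^ 2) (x : Plane) :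
    ‖normalFactor β₁ β₂ ρ x‖ ^ 2 = 1 / (1 - ρ ^ 2) *
      (β₁ ^ 2 * x 0 ^ 2 - 2 * ρ * β₁ * β₂ * x 0 * x 1 + β₂ ^ 2 * x 1 ^ 2) := by
  have h0 : normalFactor β₁ β₂ ρ x 0 =
      β₁ / Real.sqrt (1 - ρ ^ 2) * x 0 + -(ρ * β₂) / Real.sqrt (1 - ρ ^ 2) * x 1 := by
    simp [normalFactor, Matrix.toLpLin_apply, dotProduct, Fin.sum_univ_two]
  have h1 : normalFactor β₁ β₂ ρ x 1 = β₂ * x 1 := by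
    simp [normalFactor, Matrix.toLpLin_apply, dotProduct, Fin.sum_univ_two]
  have hq : Real.sqrt (1 - ρ ^ 2) ^ 2 = 1 - ρ ^ 2 := Real.sq_sqrt h.le
  have hq0 : Real.sqrt (1 - ρ ^ 2) ≠ 0 := (Real.sqrt_pos.2 h).ne'
  have h2 : β₁ / Real.sqrt (1 - ρ ^ 2) * x 0 + -(ρ * β₂) / Real.sqrt (1 - ρ ^ 2) * x 1 =
      (β₁ * x 0 - ρ * β₂ * x 1) / Real.sqrt (1 - ρ ^ 2) := by ring
  rw [Plane.norm_sq, h0, h1, h2, div_pow, hq]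
  field_simp
  ring

theorem generalNormalDensity_eq {β₁ β₂ ρ : ℝ} (h1 : 0 < β₁) (h2 : 0 < β₂) (h : 0 < 1 - ρ ^ 2) :
    generalNormalDensity β₁ β₂ ρ = fun x =>
      |LinearMap.det (normalFactor β₁ β₂ ρ)| * normalDensity₂ (normalFactor β₁ β₂ ρ x) := by
  ext x
  have hq0 : 0 < Real.sqrt (1 - ρ ^ 2) := Real.sqrt_pos.2 h
  rw [det_normalFactor, abs_of_pos (by positivity), normalDensity₂, ← Plane.norm_sq,
    norm_sq_normalFactor h, generalNormalDensity, ← mul_assoc]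
  congr 2
  · field_simp
  · field_simp

theorem designMatrix_mulVec_coefVec {d : ℕ} (t : Fin d → Plane) {β₁ β₂ ρ : ℝ}
    (h : 0 < 1 - ρ ^ 2) (p : Pairs d) :
    (designMatrix t).mulVec (coefVec β₁ β₂ ρ) p =
      ‖normalFactor β₁ β₂ ρ (t p.1.1 - t p.1.2)‖ ^ 2 := by
  rw [norm_sq_normalFactor h]
  simp [designMatrix, coefVec, Matrix.mulVec, dotProduct, Fin.sum_univ_three]
  ring

theorem weaklyConsistent_qHat {Ω Ω' : Type*} [MeasurableSpace Ω]
    [MeasurableSpace Ω'] {P : Measure Ω} [IsProbabilityMeasure P] {P' : Measure Ω'}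
    [IsProbabilityMeasure P'] {β₁ β₂ ρ : ℝ} (h1 : 0 < β₁) (h2 : 0 < β₂) (h : 0 < 1 - ρ ^ 2)
    {X : ℕ → Ω → C(Plane, ℝ)} {Zt : Ω' → C(Plane, ℝ)} (hX : MaximaConverge P X P' Zt)
    (hZ : IsModelLimit P' (generalNormalDensity β₁ β₂ ρ) Zt)
    {k : ℕ → ℕ} (hk : Tendsto k atTop atTop)
    (hkn : Tendsto (fun n : ℕ => (k n : ℝ) / (n : ℝ)) atTop (𝓝 0))
    {d : ℕ} {t : Fin d → Plane} (ht : Function.Injective t) (p : Pairs d) :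
    WeaklyConsistent P (fun n ω => qHat n (k n) (fun i => X i ω) t p)
      ((designMatrix t).mulVec (coefVec β₁ β₂ ρ) p) := by
  have hA : LinearMap.det (normalFactor β₁ β₂ ρ) ≠ 0 := by
    have hq0 : 0 < Real.sqrt (1 - ρ ^ 2) := Real.sqrt_pos.2 h
    rw [det_normalFactor]; positivity
  rw [generalNormalDensity_eq h1 h2 h] at hZ
  have he : ‖(EuclideanSpace.single 0 1 : Plane)‖ = 1 := by simp
  have := (isRadialDensity_normalDensity₂.weaklyConsistent_quantile_RHatPair he hA hX hZ hk hkn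
    (ht.ne p.2.ne)).comp (f := fun x => (2 * x) ^ 2) (by fun_prop)
  rw [halfSpaceMass_single, marginalDistFun_normalDensity₂,
    mul_div_cancel₀ _ (two_ne_zero (α := ℝ)), ← designMatrix_mulVec_coefVec t h p] at this
  exact this

theorem weaklyConsistent_aHat {Ω : Type*} [MeasurableSpace Ω] {P : Measure Ω} {k : ℕ → ℕ}
    {X : ℕ → Ω → C(Plane, ℝ)} {d : ℕ} {t : Fin d → Plane} {a : Fin 3 → ℝ}
    (hq : ∀ p, WeaklyConsistent P (fun n ω => qHat n (k n) (fun i => X i ω) t p)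
      ((designMatrix t).mulVec a p))
    (hdet : IsUnit ((designMatrix t).transpose * designMatrix t).det) (l : Fin 3) :
    WeaklyConsistent P (fun n ω => aHat n (k n) (fun i => X i ω) t l) (a l) := by
  have hc : Continuous fun q : Pairs d → ℝ =>
      (((designMatrix t).transpose * designMatrix t)⁻¹ * (designMatrix t).transpose).mulVec q l :=
    (continuous_apply l).comp (Continuous.matrix_mulVec continuous_const continuous_id)
  have := WeaklyConsistent.comp_pi hq hc.continuousAt
  rw [Matrix.mulVec_mulVec, Matrix.mul_assoc, Matrix.nonsing_inv_mul _ hdet, Matrix.one_mulVec]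
    at this
  exact this

section
variable {β₁ β₂ ρ : ℝ}

theorem coefVec_apply : coefVec β₁ β₂ ρ 0 = β₁ ^ 2 / (1 - ρ ^ 2) ∧
    coefVec β₁ β₂ ρ 1 = -2 * ρ * β₁ * β₂ / (1 - ρ ^ 2) ∧
    coefVec β₁ β₂ ρ 2 = β₂ ^ 2 / (1 - ρ ^ 2) := by
  refine ⟨?_, ?_, ?_⟩ <;> simp [coefVec] <;> ring

theorem coefVec_pos (h1 : 0 < β₁) (h2 : 0 < β₂) (h : 0 < 1 - ρ ^ 2) :
    0 < coefVec β₁ β₂ ρ 0 ∧ 0 < coefVec β₁ β₂ ρ 2 := by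
  obtain ⟨e0, -, e2⟩ := coefVec_apply (β₁ := β₁) (β₂ := β₂) (ρ := ρ)
  rw [e0, e2]
  constructor <;> positivity

theorem beta₁Of_coefVec (h1 : 0 < β₁) (h2 : 0 < β₂) (h : 0 < 1 - ρ ^ 2) :
    ContinuousAt beta₁Of (coefVec β₁ β₂ ρ) ∧ beta₁Of (coefVec β₁ β₂ ρ) = β₁ := by
  obtain ⟨e0, e1, e2⟩ := coefVec_apply (β₁ := β₁) (β₂ := β₂) (ρ := ρ)
  have hp := (coefVec_pos h1 h2 h).2.ne'
  constructor
  · have : 4 * coefVec β₁ β₂ ρ 2 ≠ 0 := mul_ne_zero four_ne_zero hp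
    exact ((continuous_apply 0).continuousAt.sub (((continuous_apply 1).pow 2).continuousAt.div
      (continuous_const.mul (continuous_apply 2)).continuousAt this)).sqrt
  · rw [beta₁Of, e0, e1, e2, ← Real.sqrt_sq h1.le]
    congr 1
    rw [Real.sqrt_sq h1.le]
    have := h.ne'
    field_simp
    ring

theorem beta₂Of_coefVec (h1 : 0 < β₁) (h2 : 0 < β₂) (h : 0 < 1 - ρ ^ 2) :
    ContinuousAt beta₂Of (coefVec β₁ β₂ ρ) ∧ beta₂Of (coefVec β₁ β₂ ρ) = β₂ := by
  obtain ⟨e0, e1, e2⟩ := coefVec_apply (β₁ := β₁) (β₂ := β₂) (ρ := ρ)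
  have hp := (coefVec_pos h1 h2 h).1.ne'
  constructor
  · have : 4 * coefVec β₁ β₂ ρ 0 ≠ 0 := mul_ne_zero four_ne_zero hp
    exact ((continuous_apply 2).continuousAt.sub (((continuous_apply 1).pow 2).continuousAt.div
      (continuous_const.mul (continuous_apply 0)).continuousAt this)).sqrt
  · rw [beta₂Of, e0, e1, e2, ← Real.sqrt_sq h2.le]
    congr 1
    rw [Real.sqrt_sq h2.le]
    have := h.ne'
    field_simp
    ring

theorem rhoOf_coefVec (h1 : 0 < β₁) (h2 : 0 < β₂) (h : 0 < 1 - ρ ^ 2) :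
    ContinuousAt rhoOf (coefVec β₁ β₂ ρ) ∧ rhoOf (coefVec β₁ β₂ ρ) = ρ := by
  obtain ⟨e0, e1, e2⟩ := coefVec_apply (β₁ := β₁) (β₂ := β₂) (ρ := ρ)
  obtain ⟨hp0, hp2⟩ := coefVec_pos h1 h2 h
  constructor
  · have : 2 * Real.sqrt (coefVec β₁ β₂ ρ 0 * coefVec β₁ β₂ ρ 2) ≠ 0 :=
      mul_ne_zero two_ne_zero (Real.sqrt_pos.2 (mul_pos hp0 hp2)).ne'
    unfold rhoOf
    fun_prop (disch := assumption)
  · have hs : β₁ ^ 2 / (1 - ρ ^ 2) * (β₂ ^ 2 / (1 - ρ ^ 2)) = (β₁ * β₂ / (1 - ρ ^ 2)) ^ 2 := by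
      ring
    rw [rhoOf, e0, e1, e2, hs, Real.sqrt_sq (by positivity)]
    have := h.ne'
    field_simp

end

end SpatialExtremes

theorem theorem3p1 {Ω Ω' : Type*} [MeasurableSpace Ω] [MeasurableSpace Ω']
    (P : Measure Ω) [IsProbabilityMeasure P] (P' : Measure Ω') [IsProbabilityMeasure P']
    (k : ℕ → ℕ) (hk : Tendsto k atTop atTop)
    (hkn : Tendsto (fun n : ℕ => (k n : ℝ) / (n : ℝ)) atTop (𝓝 0))
    (d : ℕ) (hd : 2 ≤ d) :
    -- the three models on the line
    (∀ φ₀ ∈ lineDensities, ∀ β : ℝ, 0 < β →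
      ∀ (X : ℕ → Ω → C(ℝ, ℝ)) (Zt : Ω' → C(ℝ, ℝ)) (t : Fin d → ℝ), Function.Injective t →
      MaximaConverge P X P' Zt →
      IsModelLimit P' (fun x => β * φ₀ (β * x)) Zt →
      WeaklyConsistent P
        (fun n ω => betaHatRange (distFun φ₀) n (k n) (fun i => X i ω) t) β ∧
      WeaklyConsistent P
        (fun n ω => betaHatPairs (distFun φ₀) n (k n) (fun i => X i ω) t) β) ∧
    -- the normal model and the t-model on the plane
    (∀ φ₀ ∈ sphericalDensities, ∀ β : ℝ, 0 < β →
      ∀ (X : ℕ → Ω → C(Plane, ℝ)) (Zt : Ω' → C(Plane, ℝ)) (t : Fin d → Plane),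
      Function.Injective t →
      MaximaConverge P X P' Zt →
      IsModelLimit P' (fun x => β ^ 2 * φ₀ (β • x)) Zt →
      WeaklyConsistent P
        (fun n ω => betaHatPairs (marginalDistFun φ₀) n (k n) (fun i => X i ω) t) β) ∧
    -- the exponential model on the plane
    (∀ β : ℝ, 0 < β →
      ∀ (X : ℕ → Ω → C(Plane, ℝ)) (Zt : Ω' → C(Plane, ℝ)) (t : Fin d → Plane),
      Function.Injective t →
      MaximaConverge P X P' Zt →
      IsModelLimit P' (fun x => β ^ 2 * expDensity₂ (β • x)) Zt →
      WeaklyConsistent P (fun n ω => betaHatExp n (k n) (fun i => X i ω) t) β) ∧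
    -- the general normal model on the plane
    (∀ β₁ β₂ ρ : ℝ, 0 < β₁ → 0 < β₂ → -1 < ρ → ρ < 1 →
      ∀ (X : ℕ → Ω → C(Plane, ℝ)) (Zt : Ω' → C(Plane, ℝ)) (t : Fin d → Plane),
      Function.Injective t →
      MaximaConverge P X P' Zt →
      IsModelLimit P' (generalNormalDensity β₁ β₂ ρ) Zt →
      (∀ p : Pairs d, WeaklyConsistent P (fun n ω => qHat n (k n) (fun i => X i ω) t p)
        ((designMatrix t).mulVec (coefVec β₁ β₂ ρ) p)) ∧
      (IsUnit ((designMatrix t).transpose * designMatrix t).det →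
        (∀ l, WeaklyConsistent P (fun n ω => aHat n (k n) (fun i => X i ω) t l)
          (coefVec β₁ β₂ ρ l)) ∧
        WeaklyConsistent P (fun n ω => beta₁Of (aHat n (k n) (fun i => X i ω) t)) β₁ ∧
        WeaklyConsistent P (fun n ω => beta₂Of (aHat n (k n) (fun i => X i ω) t)) β₂ ∧
        WeaklyConsistent P (fun n ω => rhoOf (aHat n (k n) (fun i => X i ω) t)) ρ)) := by
  refine ⟨fun φ₀ hφ₀ β hβ X Zt t ht hX hZ => ?_, fun φ₀ hφ₀ β hβ X Zt t ht hX hZ => ?_,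
    fun β hβ X Zt t ht hX hZ => weaklyConsistent_betaHatExp hβ hX hZ hk hkn hd ht,
    fun β₁ β₂ ρ h1 h2 hρ1 hρ2 X Zt t ht hX hZ => ?_⟩
  · have h := isRadialDensity_of_mem_lineDensities hφ₀
    refine ⟨h.weaklyConsistent_betaHatRange hβ hX hZ hk hkn hd ht, ?_⟩
    rw [← halfSpaceMass_one]
    exact h.weaklyConsistent_betaHatPairs norm_one hβ hX
      (by simpa only [Module.finrank_self, pow_one, smul_eq_mul] using hZ) hk hkn hd ht
  · have h := isRadialDensity_of_mem_sphericalDensities hφ₀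
    rw [← halfSpaceMass_single]
    exact h.weaklyConsistent_betaHatPairs (by simp) hβ hX
      (by simpa only [finrank_euclideanSpace_fin] using hZ) hk hkn hd ht
  · have hρ : 0 < 1 - ρ ^ 2 := by nlinarith
    have hq := weaklyConsistent_qHat h1 h2 hρ hX hZ hk hkn ht
    refine ⟨hq, fun hdet => ?_⟩
    have ha := weaklyConsistent_aHat hq hdet
    obtain ⟨c1, v1⟩ := beta₁Of_coefVec h1 h2 hρ
    obtain ⟨c2, v2⟩ := beta₂Of_coefVec h1 h2 hρ
    obtain ⟨c3, v3⟩ := rhoOf_coefVec h1 h2 hρ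
    refine ⟨ha, ?_, ?_, ?_⟩
    · simpa only [v1] using WeaklyConsistent.comp_pi ha c1
    · simpa only [v2] using WeaklyConsistent.comp_pi ha c2
    · simpa only [v3] using WeaklyConsistent.comp_pi ha c3
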